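/- Let $m,u\ge 1$, $n=m+u$, let $z_1,\dots,z_n$ be the points of a full sample, and let $\mathcal H$ be a class of real-valued functions, with $h(i):=h(z_i)$ and $|h(i)|\le H_0$ for all $h\in\mathcal H$, $i\in[n]$. Let $A\subseteq[n]$ (the test indices) be drawn uniformly at random among all subsets of size $u$; the training indices are $\bar A=[n]\setminus A$. Put $$\mathcal U_h(A)=\frac1u\sum_{i\in A}h(i),\qquad \mathcal L_h(\bar A)=\frac1m\sum_{i\in\bar A}h(i),\qquad \mathcal L_n(h)=\frac1n\sum_{i=1}^n h(i),\qquad T_n(h)=\frac1n\sum_{i=1}^n h(i)^2,$$ $R^+_{u}h=\mathcal U_h(A)-\mathcal L_n(h)$, $R^+_{m}h=\mathcal L_h(\bar A)-\mathcal L_n(h)$ and $R^-_{m}h=-R^+_{m}h$. A function $\psi:[0,\infty)\to[0,\infty)$ is called sub-root if it is nondecreasing and $\psi(r)/\sqrt r$ is nonincreasing for $r>0$; its fixed point is the positive solution of $\psi(r)=r$, which is unique (and it is $0$ if $\psi\equiv0$). Let $K>1$. There are a constant $c_0>0$ depending only on $K$, and, for every $H_0>0$, a constant $c_1>0$ depending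 only on $K$ and $H_0$, such that the following holds for all $m,u$, all samples and all classes $\mathcal H$ as above. Let $\tilde T_n:\mathcal H\to[0,\infty)$ satisfy $T_n(h)\le\tilde T_n(h)$ for all $h\in\mathcal H$. Let $\psi_u,\psi_m$ be sub-root functions with fixed points $r_u,r_m$, such that (a supremum over the empty set being $0$) $$\psi_u(r)\ \ge\ \max\Big\{\mathbb E\sup_{h\in\mathcal H,\ \tilde T_n(h)\le r}R^+_{u}h,\ \ \mathbb E\sup_{h\in\mathcal H,\ \tilde T_n(h)\le r}R^+_{u}h^2\Big\}\quad\text{for all } r\ge r_u,$$ $$\psi_m(r)\ \ge\ \max\Big\{\mathbb E\sup_{h\in\mathcal H,\ \tilde T_n(h)\le r}R^-_{m}h,\ \ \mathbb E\sup_{h\in\mathcal H,\ \tilde T_n(h)\le r}R^+_{m}h^2\Big\}\quad\text{for all } r\ge r_m.$$ Then for every $x\ge 1$, and even for every $x>0$ if $\mathcal H$ contains a function $h_0$ that vanishes on the sample and has $\tilde T_n(h_0)\le\max\{r_u,r_m\}$, with probability at least $1-e^{-x}$, $$\mathcal U_h(A)\ \le\ \mathcal L_h(\bar A)+\frac{\tilde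 T_n(h)}{K}+c_0\,(r_u+r_m)+\frac{c_1\,x}{\min\{m,u\}}\qquad\text{for all } h\in\mathcal H .$$ -/

import Mathlib

open scoped BigOperators

noncomputable section

namespace TLC

/-- Average of `g` over a finite set `A` of indices. With `A` the test set this is the test loss
`U_h^{(u)}`, with `A` the training set it is the training loss `L_h^{(m)}`. -/
def avg {n : ℕ} (A : Finset (Fin n)) (g : Fin n → ℝ) : ℝ :=
  (∑ i ∈ A, g i) / (A.card : ℝ)

/-- The average `L_n(g)` over the full sample. -/
def fullAvg {n : ℕ} (g : Fin n → ℝ) : ℝ :=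
  (∑ i, g i) / (n : ℝ)

/-- The values `h(i) = h(z_i)` of a function on the full sample `z_1, …, z_n`. -/
def onSample {n : ℕ} {Z : Type*} (z : Fin n → Z) (h : Z → ℝ) : Fin n → ℝ :=
  fun i => h (z i)

/-- The values `h²(i)` of the square of a function on the full sample. -/
def onSampleSq {n : ℕ} {Z : Type*} (z : Fin n → Z) (h : Z → ℝ) : Fin n → ℝ :=
  fun i => h (z i) ^ 2

/-- The average squared loss `T_n(h)`. -/
def Tn {n : ℕ} {Z : Type*} (z : Fin n → Z) (h : Z → ℝ) : ℝ :=
  fullAvg (onSampleSq z h)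

/-- The possible test index sets: all subsets of size `u` of the `m + u` indices. -/
def testSets (m u : ℕ) : Finset (Finset (Fin (m + u))) :=
  Finset.powersetCard u Finset.univ

/-- Expectation over a test index set drawn uniformly at random among all subsets of size `u`
(sampling without replacement). -/
def expect (m u : ℕ) (F : Finset (Fin (m + u)) → ℝ) : ℝ :=
  (∑ A ∈ testSets m u, F A) / ((testSets m u).card : ℝ)

open Classical in
/-- Probability of an event under the same uniform sampling without replacement. -/
def prob (m u : ℕ) (E : Finset (Fin (m + u)) → Prop) : ℝ :=
  (((testSets m u).filter E).card : ℝ) / ((testSets m u).card : ℝ)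

/-- `R⁺_u g`, as a function of the test index set `A`. -/
def RuPlus {n : ℕ} (A : Finset (Fin n)) (g : Fin n → ℝ) : ℝ :=
  avg A g - fullAvg g

/-- `R⁺_m g`, as a function of the test index set `A`; the training index set is `Aᶜ`. -/
def RmPlus {n : ℕ} (A : Finset (Fin n)) (g : Fin n → ℝ) : ℝ :=
  avg Aᶜ g - fullAvg g

/-- `R⁻_m g = -R⁺_m g`. -/
def RmMinus {n : ℕ} (A : Finset (Fin n)) (g : Fin n → ℝ) : ℝ :=
  -RmPlus A g

/-- The localized class `{h ∈ H : T(h) ≤ r}`. -/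
def localized {Z : Type*} (H : Set (Z → ℝ)) (T : (Z → ℝ) → ℝ) (r : ℝ) : Set (Z → ℝ) :=
  {h | h ∈ H ∧ T h ≤ r}

/-- Sub-root functions on `[0, ∞)`. -/
structure IsSubRoot (ψ : ℝ → ℝ) : Prop where
  nonneg : ∀ r, 0 ≤ r → 0 ≤ ψ r
  mono : MonotoneOn ψ (Set.Ici 0)
  anti : AntitoneOn (fun r => ψ r / Real.sqrt r) (Set.Ioi 0)

/-- `r` is the fixed point of the sub-root function `ψ`. A sub-root function that is not
identically zero has exactly one positive fixed point, possibly besides the trivial one `0`,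
and the positive one is meant; the zero function has only the fixed point `0`. Both cases are
covered by taking the greatest fixed point. -/
def IsFixedPointOf (ψ : ℝ → ℝ) (r : ℝ) : Prop :=
  IsGreatest {s : ℝ | 0 ≤ s ∧ ψ s = s} r

end TLC

end

/-!
A uniform `k`-subset `A` is compared with an independent copy `B`. Matching `A \ B` with `B \ A`,
the joint law of the pair is invariant under exchanging any set `t` of matched points, so one may
average over all `t`. On the resulting cube, induction on the dimension bounds the exponential
moment of the supremum penalized by the squared differences of the matched values, minus the same
supremum at the complementary exchange; each coordinate costs one scalar inequality. The squares are
paid for by adding a quadratic term to the process, whose expected supremum is controlled by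
hypothesis.

This Bernstein-type tail bound is applied to the class rescaled by `4 ^ (-p)` on the shell
`T ≤ 4 ^ p * r`. A sub-root function with greatest fixed point `s` satisfies `ψ r ≤ √(r * s)` for
`r ≥ s`, so the rescaled shells contribute a geometric series. To sum suprema that may be negative,
they are first replaced by their positive parts, which costs the mean absolute deviation of a single
member of the class: nothing if that member vanishes, a variance bound if `x ≥ 1`.

Finally `n * R⁺ g = |Aᶜ| * (avg A g - avg Aᶜ g)`, so it suffices to treat the smaller of the two
index sets, with `-h` in place of `h` when that is the training set.
-/

namespace TLC

open Finset Real

lemma mul_exp_neg_le {d : ℝ} (hd : 0 ≤ d) : d * exp (-d) ≤ (1 - exp (-d) ^ 2) / 2 := by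
  have h_sinh : d ≤ (exp d - exp (-d)) / 2 := sinh_eq d ▸ self_le_sinh_iff.2 hd
  have h_one : exp d * exp (-d) = 1 := by rw [← exp_add, add_neg_cancel, exp_zero]
  nlinarith [exp_pos (-d)]

/- The exponent is a quadratic in `θ`; its value at `θ = 1 - exp (-d)` is at most `θ`, and then
`exp θ ≤ (2 + θ) / (2 - θ)` is exactly what is left to prove. -/
lemma exists_one_add_exp_mul_one_add_exp_neg_le {d : ℝ} (hd : 0 ≤ d) :
    ∃ θ ∈ Set.Icc (0 : ℝ) 1,
      (1 + exp (θ ^ 2 / 2 + (1 - θ) * d)) * (1 + exp (-d)) ≤ 4 := by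
  obtain ⟨θ, hθ⟩ : ∃ θ, exp (-d) = 1 - θ := ⟨1 - exp (-d), by ring⟩
  have hθ₁ : θ < 1 := by linarith [exp_pos (-d)]
  have hθ₀ : 0 ≤ θ := by linarith [exp_le_one_iff.2 (neg_nonpos.2 hd)]
  refine ⟨θ, ⟨hθ₀, hθ₁.le⟩, ?_⟩
  have h_exponent : θ ^ 2 / 2 + (1 - θ) * d ≤ θ := by
    have := mul_exp_neg_le hd
    rw [hθ] at this
    linarith
  have h_exp : exp θ * (2 - θ) ≤ 2 + θ :=
    (le_div_iff₀ (by linarith)).1 (exp_le_two_add_div_two_sub hθ₀ (by linarith))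
  calc (1 + exp (θ ^ 2 / 2 + (1 - θ) * d)) * (1 + exp (-d))
      ≤ (1 + exp θ) * (2 - θ) := by
        rw [hθ]
        gcongr
        linarith
    _ ≤ 4 := by linarith

lemma sum_exp_convexCombination_le {β : Type*} {s : Finset β} {F₀ F₁ : β → ℝ} {ℓ₀ ℓ₁ θ : ℝ}
    (h₀ : ∑ t ∈ s, exp (F₀ t) ≤ exp ℓ₀) (h₁ : ∑ t ∈ s, exp (F₁ t) ≤ exp ℓ₁)
    (hθ : θ ∈ Set.Icc (0 : ℝ) 1) :
    ∑ t ∈ s, exp ((1 - θ) * F₀ t + θ * F₁ t) ≤ exp ((1 - θ) * ℓ₀ + θ * ℓ₁) := by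
  have h_normalize {F : β → ℝ} {ℓ : ℝ} (h : ∑ t ∈ s, exp (F t) ≤ exp ℓ) :
      ∑ t ∈ s, exp (F t - ℓ) ≤ 1 := by
    simp only [exp_sub, ← sum_div]
    exact div_le_one_of_le₀ h (exp_nonneg _)
  have h_convex (t : β) : exp ((1 - θ) * (F₀ t - ℓ₀) + θ * (F₁ t - ℓ₁)) ≤
      (1 - θ) * exp (F₀ t - ℓ₀) + θ * exp (F₁ t - ℓ₁) :=
    convexOn_exp.2 (Set.mem_univ _) (Set.mem_univ _) (sub_nonneg.2 hθ.2) hθ.1 (by ring)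
  calc ∑ t ∈ s, exp ((1 - θ) * F₀ t + θ * F₁ t)
      = exp ((1 - θ) * ℓ₀ + θ * ℓ₁) *
          ∑ t ∈ s, exp ((1 - θ) * (F₀ t - ℓ₀) + θ * (F₁ t - ℓ₁)) := by
        simp only [mul_sum, ← exp_add]
        exact sum_congr rfl fun t _ => by ring_nf
    _ ≤ exp ((1 - θ) * ℓ₀ + θ * ℓ₁) *
          ((1 - θ) * ∑ t ∈ s, exp (F₀ t - ℓ₀) + θ * ∑ t ∈ s, exp (F₁ t - ℓ₁)) := by
        gcongr
        simp only [mul_sum, ← sum_add_distrib]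
        exact sum_le_sum fun t _ => h_convex t
    _ ≤ exp ((1 - θ) * ℓ₀ + θ * ℓ₁) * 1 := by
        gcongr
        nlinarith [h_normalize h₀, h_normalize h₁, hθ.1, hθ.2]
    _ = exp ((1 - θ) * ℓ₀ + θ * ℓ₁) := mul_one _

lemma le_iSup_of_finite {ι : Type*} [Finite ι] (f : ι → ℝ) (j : ι) : f j ≤ ⨆ i, f i :=
  le_ciSup (Set.finite_range f).bddAbove j

section Cube

variable {ι : Type*} [Finite ι] [Nonempty ι] {β : Type*} {s : Finset β}

lemma sum_exp_iSup_sub_sq_le {f : ι → β → ℝ} {c : ι → ℝ} {ℓ₀ ℓ₁ θ : ℝ}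
    (h₀ : ∑ t ∈ s, exp (⨆ j, f j t) ≤ exp ℓ₀)
    (h₁ : ∑ t ∈ s, exp (⨆ j, (f j t + c j)) ≤ exp ℓ₁) (hθ : θ ∈ Set.Icc (0 : ℝ) 1) :
    ∑ t ∈ s, exp (⨆ j, (f j t - c j ^ 2 / 2)) ≤
      exp (θ ^ 2 / 2 + ((1 - θ) * ℓ₀ + θ * ℓ₁)) := by
  have h_sup (t : β) : ⨆ j, (f j t - c j ^ 2 / 2) ≤
      θ ^ 2 / 2 + ((1 - θ) * (⨆ j, f j t) + θ * ⨆ j, (f j t + c j)) := by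
    refine ciSup_le fun j => ?_
    nlinarith [sq_nonneg (θ + c j),
      mul_le_mul_of_nonneg_left (le_iSup_of_finite (fun j => f j t) j) (sub_nonneg.2 hθ.2),
      mul_le_mul_of_nonneg_left (le_iSup_of_finite (fun j => f j t + c j) j) hθ.1]
  calc ∑ t ∈ s, exp (⨆ j, (f j t - c j ^ 2 / 2))
      ≤ ∑ t ∈ s, exp (θ ^ 2 / 2) *
          exp ((1 - θ) * (⨆ j, f j t) + θ * ⨆ j, (f j t + c j)) := by
        gcongr with t
        exact (exp_le_exp.2 (h_sup t)).trans_eq (exp_add _ _)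
    _ ≤ exp (θ ^ 2 / 2) * exp ((1 - θ) * ℓ₀ + θ * ℓ₁) := by
        rw [← mul_sum]
        gcongr
        exact sum_exp_convexCombination_le h₀ h₁ hθ
    _ = exp (θ ^ 2 / 2 + ((1 - θ) * ℓ₀ + θ * ℓ₁)) := (exp_add _ _).symm

lemma sum_exp_iSup_add_mul_le_of_le {f : ι → β → ℝ} {c : ι → ℝ} {p₀ p₁ N : ℝ}
    (hN : 0 < N) (hp₀ : 0 < p₀) (hp : p₀ ≤ p₁)
    (h₀ : (∑ t ∈ s, exp (⨆ j, f j t)) * p₀ ≤ N)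
    (h₁ : (∑ t ∈ s, exp (⨆ j, (f j t + c j))) * p₁ ≤ N) :
    (∑ t ∈ s, exp (⨆ j, (f j t - c j ^ 2 / 2)) +
      ∑ t ∈ s, exp (⨆ j, (f j t + c j - c j ^ 2 / 2))) * (p₀ + p₁) ≤ 4 * N := by
  have hp₁ : 0 < p₁ := hp₀.trans_le hp
  obtain ⟨d, hd⟩ : ∃ d, exp d = p₁ / p₀ := ⟨_, exp_log (by positivity)⟩
  obtain ⟨ℓ, hℓ⟩ : ∃ ℓ, exp ℓ = N / p₁ := ⟨_, exp_log (by positivity)⟩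
  have hd₀ : 0 ≤ d := by rwa [← one_le_exp_iff, hd, one_le_div hp₀]
  obtain ⟨θ, hθ, h_two⟩ := exists_one_add_exp_mul_one_add_exp_neg_le hd₀
  have h₀' : ∑ t ∈ s, exp (⨆ j, f j t) ≤ exp (ℓ + d) := by
    rwa [exp_add, hℓ, hd, div_mul_div_cancel₀ hp₁.ne', le_div_iff₀ hp₀]
  have h₁' : ∑ t ∈ s, exp (⨆ j, (f j t + c j)) ≤ exp ℓ := by rwa [hℓ, le_div_iff₀ hp₁]
  have h_face₀ : ∑ t ∈ s, exp (⨆ j, (f j t - c j ^ 2 / 2)) ≤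
      exp ℓ * exp (θ ^ 2 / 2 + (1 - θ) * d) := by
    rw [← exp_add]
    exact (sum_exp_iSup_sub_sq_le h₀' h₁' hθ).trans_eq (by ring_nf)
  have h_face₁ : ∑ t ∈ s, exp (⨆ j, (f j t + c j - c j ^ 2 / 2)) ≤ exp ℓ := by
    refine (sum_le_sum fun t _ => exp_le_exp.2 ?_).trans h₁'
    exact ciSup_mono (Set.finite_range _).bddAbove fun j => by linarith [sq_nonneg (c j)]
  have hp₀_eq : p₀ = p₁ * exp (-d) := by rw [exp_neg, hd]; field_simp
  calc _ ≤ (exp ℓ * exp (θ ^ 2 / 2 + (1 - θ) * d) + exp ℓ) * (p₁ * exp (-d) + p₁) := by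
        rw [← hp₀_eq]
        gcongr
    _ = N * ((1 + exp (θ ^ 2 / 2 + (1 - θ) * d)) * (1 + exp (-d))) := by
        rw [hℓ]
        field_simp
        ring
    _ ≤ 4 * N := by linarith [mul_le_mul_of_nonneg_left h_two hN.le]

lemma sum_exp_iSup_add_mul_le {f : ι → β → ℝ} {c : ι → ℝ} {p₀ p₁ N : ℝ}
    (hN : 0 < N) (hp₀ : 0 < p₀) (hp₁ : 0 < p₁)
    (h₀ : (∑ t ∈ s, exp (⨆ j, f j t)) * p₀ ≤ N)
    (h₁ : (∑ t ∈ s, exp (⨆ j, (f j t + c j))) * p₁ ≤ N) :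
    (∑ t ∈ s, exp (⨆ j, (f j t - c j ^ 2 / 2)) +
      ∑ t ∈ s, exp (⨆ j, (f j t + c j - c j ^ 2 / 2))) * (p₀ + p₁) ≤ 4 * N := by
  rcases le_total p₀ p₁ with hp | hp
  · exact sum_exp_iSup_add_mul_le_of_le hN hp₀ hp h₀ h₁
  · have h_swap := sum_exp_iSup_add_mul_le_of_le (f := fun j t => f j t + c j)
      (c := fun j => -c j) hN hp₁ hp h₁ (by simpa only [add_neg_cancel_right] using h₀)
    simp only [add_neg_cancel_right, neg_sq] at h_swap
    rwa [add_comm, add_comm p₀]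

theorem sum_exp_iSup_mul_sum_exp_neg_iSup_le {κ : Type*} (s : Finset κ) (b : ι → κ → ℝ)
    (a : ι → ℝ) :
    (∑ t ∈ s.powerset, exp (⨆ j, (a j + ∑ i ∈ t, b j i - (∑ i ∈ s, b j i ^ 2) / 2))) *
      (∑ t ∈ s.powerset, exp (-⨆ j, (a j + ∑ i ∈ t, b j i))) ≤ 4 ^ #s := by
  classical
  induction s using Finset.induction_on generalizing a with
  | empty => simp [← exp_add]
  | insert i s his ih =>
    have h_notMem {t : Finset κ} (ht : t ∈ s.powerset) : i ∉ t :=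
      fun hit => his (mem_powerset.1 ht hit)
    have h_pos (a : ι → ℝ) : 0 < ∑ t ∈ s.powerset, exp (-⨆ j, (a j + ∑ i ∈ t, b j i)) :=
      sum_pos (fun _ _ => exp_pos _) ⟨∅, empty_mem_powerset s⟩
    have h_reorder (A x S c : ℝ) : A + x + S - c = A + S - c + x := by ring
    have ih₁ := ih fun j => a j + b j i
    simp only [h_reorder] at ih₁
    convert sum_exp_iSup_add_mul_le (by positivity) (h_pos a) (h_pos fun j => a j + b j i)
      (ih a) ih₁ using 1
    · rw [sum_powerset_insert his, sum_powerset_insert his]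
      simp only [sum_insert his]
      refine congr_arg₂ _ (congr_arg₂ _ ?_ ?_) (congr_arg₂ _ rfl ?_) <;>
        refine sum_congr rfl fun t ht => congr_arg exp ?_
      · exact iSup_congr fun j => by ring
      · exact iSup_congr fun j => by rw [sum_insert (h_notMem ht)]; ring
      · simp only [sum_insert (h_notMem ht), add_assoc]
    · rw [card_insert_of_notMem his, pow_succ']

end Cube

section Swap

variable {α : Type*} [DecidableEq α] {A B : Finset α}

/-- The points of `A \ B` and their partners in `B \ A` under a matching `φ`; the flag of a pair
tells whether the point or its partner is meant. -/
def partnerEmbedding (φ : ↥(A \ B) ≃ ↥(B \ A)) : ↥(A \ B) × Bool ↪ α where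
  toFun p := bif p.2 then φ p.1 else p.1
  inj' := by
    have h_ne (x y : ↥(A \ B)) : (φ x : α) ≠ y := fun h =>
      (mem_sdiff.1 (φ x).2).2 (h ▸ (mem_sdiff.1 y.2).1)
    rintro ⟨x, _ | _⟩ ⟨y, _ | _⟩ h
    · simpa only [Prod.mk.injEq, and_true] using Subtype.ext h
    · exact absurd h.symm (h_ne y x)
    · exact absurd h (h_ne x y)
    · simpa only [Prod.mk.injEq, and_true] using φ.injective (Subtype.ext h)

@[simp]
lemma partnerEmbedding_false (φ : ↥(A \ B) ≃ ↥(B \ A)) (x : ↥(A \ B)) :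
    partnerEmbedding φ (x, false) = x := rfl

@[simp]
lemma partnerEmbedding_true (φ : ↥(A \ B) ≃ ↥(B \ A)) (x : ↥(A \ B)) :
    partnerEmbedding φ (x, true) = φ x := rfl

/-- The permutation that exchanges `x` and its partner `φ x` for every `x ∈ t` and fixes all other
points, where `φ` matches `A \ B` with `B \ A`. -/
noncomputable def swapPerm (φ : ↥(A \ B) ≃ ↥(B \ A)) (t : Finset ↥(A \ B)) : Equiv.Perm α :=
  Equiv.Perm.viaEmbedding (Equiv.prodShear (Equiv.refl ↥(A \ B)) fun x =>
    if x ∈ t then Equiv.boolNot else Equiv.refl Bool) (partnerEmbedding φ)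

variable (φ : ↥(A \ B) ≃ ↥(B \ A)) (t : Finset ↥(A \ B))

lemma swapPerm_apply (x : ↥(A \ B)) : swapPerm φ t x = if x ∈ t then (φ x : α) else x := by
  refine (Equiv.Perm.viaEmbedding_apply _ (partnerEmbedding φ) (x, false)).trans ?_
  by_cases hx : x ∈ t <;> simp [hx]

lemma swapPerm_apply_partner (x : ↥(A \ B)) :
    swapPerm φ t (φ x) = if x ∈ t then (x : α) else φ x := by
  refine (Equiv.Perm.viaEmbedding_apply _ (partnerEmbedding φ) (x, true)).trans ?_
  by_cases hx : x ∈ t <;> simp [hx]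

lemma swapPerm_apply_of_mem_inter {x : α} (hx : x ∈ A ∩ B) : swapPerm φ t x = x := by
  refine Equiv.Perm.viaEmbedding_apply_of_notMem _ _ _ ?_
  rw [mem_inter] at hx
  rintro ⟨⟨y, _ | _⟩, rfl⟩
  · exact (mem_sdiff.1 y.2).2 hx.2
  · exact (mem_sdiff.1 (φ y).2).2 hx.1

variable (A B) in
lemma sum_eq_sum_sdiff_add_sum_inter (g : α → ℝ) :
    ∑ x ∈ A, g x = ∑ x : ↥(A \ B), g x + ∑ x ∈ A ∩ B, g x := by
  rw [sum_coe_sort, add_comm, sum_inter_add_sum_sdiff]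

lemma sum_eq_sum_partner_add_sum_inter (g : α → ℝ) :
    ∑ x ∈ B, g x = ∑ x : ↥(A \ B), g (φ x) + ∑ x ∈ A ∩ B, g x := by
  rw [sum_eq_sum_sdiff_add_sum_inter B A, inter_comm, Equiv.sum_comp φ fun y => g y]

lemma sum_inter_swapPerm (g : α → ℝ) :
    ∑ x ∈ A ∩ B, g (swapPerm φ t x) = ∑ x ∈ A ∩ B, g x :=
  sum_congr rfl fun _ hx => by rw [swapPerm_apply_of_mem_inter φ t hx]

lemma sum_swapPerm_left (g : α → ℝ) :
    ∑ x ∈ A, g (swapPerm φ t x) = ∑ x ∈ A, g x + ∑ x ∈ t, (g (φ x) - g x) := by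
  have h_swap (x : ↥(A \ B)) :
      g (swapPerm φ t x) = g x + if x ∈ t then g (φ x) - g x else 0 := by
    rw [swapPerm_apply]
    split_ifs <;> ring
  rw [sum_eq_sum_sdiff_add_sum_inter A B, sum_eq_sum_sdiff_add_sum_inter A B g,
    sum_inter_swapPerm, sum_congr rfl fun x _ => h_swap x, sum_add_distrib, sum_ite_mem, univ_inter]
  ring

lemma sum_swapPerm_right (g : α → ℝ) :
    ∑ x ∈ B, g (swapPerm φ t x) = ∑ x ∈ A, g x + ∑ x ∈ tᶜ, (g (φ x) - g x) := by
  have h_swap (x : ↥(A \ B)) :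
      g (swapPerm φ t (φ x)) = g x + if x ∈ tᶜ then g (φ x) - g x else 0 := by
    rw [swapPerm_apply_partner]
    by_cases hx : x ∈ t <;> simp [hx]
  rw [sum_eq_sum_partner_add_sum_inter φ, sum_eq_sum_sdiff_add_sum_inter A B g,
    sum_inter_swapPerm, sum_congr rfl fun x _ => h_swap x, sum_add_distrib, sum_ite_mem, univ_inter]
  ring

lemma sum_swapPerm_left_add_right (g : α → ℝ) :
    ∑ x ∈ A, g (swapPerm φ t x) + ∑ x ∈ B, g (swapPerm φ t x) = ∑ x ∈ A, g x + ∑ x ∈ B, g x := by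
  rw [sum_swapPerm_left, sum_swapPerm_right, sum_eq_sum_partner_add_sum_inter φ g,
    add_add_add_comm, sum_add_sum_compl, sum_sub_distrib, sum_eq_sum_sdiff_add_sum_inter A B g]
  ring

lemma sum_sq_sub_partner_div_two_le (g : α → ℝ) :
    (∑ x, (g (φ x) - g x) ^ 2) / 2 ≤ ∑ x ∈ A, g x ^ 2 + ∑ x ∈ B, g x ^ 2 := by
  have h_inter : 0 ≤ ∑ x ∈ A ∩ B, g x ^ 2 := sum_nonneg fun _ _ => sq_nonneg _
  have h_partner : (∑ x, (g (φ x) - g x) ^ 2) / 2 ≤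
      ∑ x : ↥(A \ B), g x ^ 2 + ∑ x : ↥(A \ B), g (φ x) ^ 2 := by
    rw [sum_div, ← sum_add_distrib]
    exact sum_le_sum fun x _ => by nlinarith [sq_nonneg (g (φ x) + g x)]
  rw [sum_eq_sum_sdiff_add_sum_inter A B, sum_eq_sum_partner_add_sum_inter φ fun x => g x ^ 2]
  linarith

end Swap

lemma sum_exp_half_le {β : Type*} {s : Finset β} {F G : β → ℝ} {N : ℝ} (hN : 0 ≤ N)
    (h : (∑ t ∈ s, exp (F t)) * (∑ t ∈ s, exp (G t)) ≤ N ^ 2) :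
    ∑ t ∈ s, exp ((F t + G t) / 2) ≤ N := by
  have h_sq (y : ℝ) : exp (y / 2) ^ 2 = exp y := by rw [sq, ← exp_add, add_halves]
  have h_cauchy := sum_mul_sq_le_sq_mul_sq s (fun t => exp (F t / 2)) fun t => exp (G t / 2)
  simp only [h_sq, ← exp_add, ← add_div] at h_cauchy
  exact (abs_le_of_sq_le_sq' (h_cauchy.trans h) hN).2

section PairGap

variable {ι α : Type*}

/-- How much the maximum over `j` of `a j + ∑ x ∈ A, q j x`, penalized by the sums of squares over
`A` and `B`, exceeds the corresponding unpenalized maximum over the sample `B`. -/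
noncomputable def pairGap (a : ι → ℝ) (q : ι → α → ℝ) (A B : Finset α) : ℝ :=
  (⨆ j, (a j + ∑ x ∈ A, q j x - (∑ x ∈ A, q j x ^ 2 + ∑ x ∈ B, q j x ^ 2))) -
    ⨆ j, (a j + ∑ x ∈ B, q j x)

lemma pairGap_map (a : ι → ℝ) (q : ι → α → ℝ) (A B : Finset α) (σ : Equiv.Perm α) :
    pairGap a q (A.map σ.toEmbedding) (B.map σ.toEmbedding) =
      pairGap a (fun j x => q j (σ x)) A B := by
  simp only [pairGap, sum_map, Equiv.coe_toEmbedding]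

variable [Finite ι] [Nonempty ι]

lemma sum_exp_pairGap_swapPerm_le [DecidableEq α] {A B : Finset α} (φ : ↥(A \ B) ≃ ↥(B \ A))
    (a : ι → ℝ) (q : ι → α → ℝ) :
    ∑ t, exp (pairGap a (fun j x => q j (swapPerm φ t x)) A B / 2) ≤
      2 ^ Fintype.card ↥(A \ B) := by
  let b (j : ι) (x : ↥(A \ B)) : ℝ := q j (φ x) - q j x
  let c (j : ι) : ℝ := a j + ∑ x ∈ A, q j x
  have h_gap (t : Finset ↥(A \ B)) : pairGap a (fun j x => q j (swapPerm φ t x)) A B ≤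
      (⨆ j, (c j + ∑ x ∈ t, b j x - (∑ x, b j x ^ 2) / 2)) + -⨆ j, (c j + ∑ x ∈ tᶜ, b j x) := by
    simp only [pairGap, sub_eq_add_neg _ (iSup _), sum_swapPerm_right φ t (q _), ← add_assoc]
    refine add_le_add (ciSup_mono (Set.finite_range _).bddAbove fun j => sub_le_sub ?_ ?_) le_rfl
    · rw [sum_swapPerm_left φ t (q j), ← add_assoc]
    · rw [sum_swapPerm_left_add_right φ t fun x => q j x ^ 2]
      exact sum_sq_sub_partner_div_two_le φ (q j)
  have h_compl : ∑ t, exp (-⨆ j, (c j + ∑ x ∈ tᶜ, b j x)) =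
      ∑ t, exp (-⨆ j, (c j + ∑ x ∈ t, b j x)) :=
    Equiv.sum_comp (compl_involutive.toPerm _) fun t => exp (-⨆ j, (c j + ∑ x ∈ t, b j x))
  have h_cube := sum_exp_iSup_mul_sum_exp_neg_iSup_le univ b c
  rw [powerset_univ, ← h_compl, card_univ, show (4 : ℝ) = 2 ^ 2 by norm_num, pow_right_comm]
    at h_cube
  exact (sum_le_sum fun t _ => exp_le_exp.2 (by gcongr; exact h_gap t)).trans
    (sum_exp_half_le (by positivity) h_cube)

lemma expect_perm_exp_pairGap_le [Fintype α] [DecidableEq α] {A B : Finset α} (h : #A = #B)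
    (a : ι → ℝ) (q : ι → α → ℝ) :
    𝔼 σ : Equiv.Perm α, exp (pairGap a (fun j x => q j (σ x)) A B / 2) ≤ 1 := by
  let φ : ↥(A \ B) ≃ ↥(B \ A) := equivOfCardEq (card_sdiff_comm h)
  have h_translate (t : Finset ↥(A \ B)) :
      𝔼 σ : Equiv.Perm α, exp (pairGap a (fun j x => q j (σ x)) A B / 2) =
        𝔼 σ : Equiv.Perm α, exp (pairGap a (fun j x => q j (σ (swapPerm φ t x))) A B / 2) :=
    (Fintype.expect_equiv (Equiv.mulRight (swapPerm φ t)) _ _ fun _ => rfl).symm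
  calc 𝔼 σ : Equiv.Perm α, exp (pairGap a (fun j x => q j (σ x)) A B / 2)
      = 𝔼 σ : Equiv.Perm α, 𝔼 t : Finset ↥(A \ B),
          exp (pairGap a (fun j x => q j (σ (swapPerm φ t x))) A B / 2) := by
        rw [expect_comm, expect_congr rfl fun t _ => (h_translate t).symm,
          expect_const univ_nonempty]
    _ ≤ 1 := by
        refine expect_le univ_nonempty fun σ _ => ?_
        rw [Fintype.expect_eq_sum_div_card, Fintype.card_finset]
        refine div_le_one_of_le₀ ?_ (by positivity)
        exact_mod_cast sum_exp_pairGap_swapPerm_le φ a fun j x => q j (σ x)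

lemma expect_powersetCard_map [Fintype α] (k : ℕ) (σ : Equiv.Perm α) (F : Finset α → ℝ) :
    𝔼 A ∈ powersetCard k univ, F (A.map σ.toEmbedding) = 𝔼 A ∈ powersetCard k univ, F A :=
  expect_equiv (Equiv.finsetCongr σ) (fun A => by simp [mem_powersetCard]) fun _ _ => rfl

theorem expect_expect_exp_pairGap_le [Fintype α] {k : ℕ} (hk : k ≤ Fintype.card α)
    (a : ι → ℝ) (q : ι → α → ℝ) :
    𝔼 A ∈ powersetCard k univ, 𝔼 B ∈ powersetCard k univ, exp (pairGap a q A B / 2) ≤ 1 := by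
  classical
  have h_perm (σ : Equiv.Perm α) :
      𝔼 A ∈ powersetCard k univ, 𝔼 B ∈ powersetCard k univ, exp (pairGap a q A B / 2) =
        𝔼 A ∈ powersetCard k univ, 𝔼 B ∈ powersetCard k univ,
          exp (pairGap a (fun j x => q j (σ x)) A B / 2) := by
    rw [← expect_powersetCard_map k σ]
    refine expect_congr rfl fun A _ => ?_
    rw [← expect_powersetCard_map k σ]
    simp only [pairGap_map]
  have h_nonempty : (powersetCard k (univ : Finset α)).Nonempty := powersetCard_nonempty.2 hk
  calc 𝔼 A ∈ powersetCard k univ, 𝔼 B ∈ powersetCard k univ, exp (pairGap a q A B / 2)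
      = 𝔼 A ∈ powersetCard k univ, 𝔼 B ∈ powersetCard k univ, 𝔼 σ : Equiv.Perm α,
          exp (pairGap a (fun j x => q j (σ x)) A B / 2) := by
        simp only [← expect_comm (univ : Finset (Equiv.Perm α)), ← h_perm,
          expect_const univ_nonempty]
    _ ≤ 1 := expect_le h_nonempty fun A hA => expect_le h_nonempty fun B hB =>
        expect_perm_exp_pairGap_le
          ((mem_powersetCard_univ.1 hA).trans (mem_powersetCard_univ.1 hB).symm) a q

end PairGap

lemma exp_expect_le {β : Type*} {s : Finset β} (hs : s.Nonempty) (F : β → ℝ) :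
    exp (𝔼 i ∈ s, F i) ≤ 𝔼 i ∈ s, exp (F i) := by
  have hs' : (#s : ℝ) ≠ 0 := Nat.cast_ne_zero.2 hs.card_ne_zero
  have h_jensen := convexOn_exp.map_sum_le (t := s) (w := fun _ => (#s : ℝ)⁻¹) (p := F)
    (fun _ _ => by positivity) (by rw [sum_const, nsmul_eq_mul, mul_inv_cancel₀ hs'])
    fun _ _ => Set.mem_univ _
  simpa only [smul_eq_mul, ← mul_sum, expect_eq_sum_div_card, div_eq_inv_mul] using h_jensen

lemma iSup_expect_le {ι β : Type*} [Finite ι] [Nonempty ι] (s : Finset β) (F : ι → β → ℝ) :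
    ⨆ j, 𝔼 i ∈ s, F j i ≤ 𝔼 i ∈ s, ⨆ j, F j i :=
  ciSup_le fun j => expect_le_expect fun i _ => le_iSup_of_finite (fun j => F j i) j

lemma expect_abs_le_sqrt {β : Type*} (s : Finset β) (F : β → ℝ) :
    𝔼 i ∈ s, |F i| ≤ √(𝔼 i ∈ s, F i ^ 2) := by
  rcases s.eq_empty_or_nonempty with rfl | hs
  · simp
  · refine le_sqrt_of_sq_le ?_
    simpa only [mul_one, sq_abs, one_pow, expect_const hs] using
      expect_mul_sq_le_sq_mul_sq s (fun i => |F i|) fun _ => 1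

lemma eq_of_perm_invariant {α β : Type*} {P : α → α → β}
    (hP : ∀ (σ : Equiv.Perm α) x y, P (σ x) (σ y) = P x y)
    {x y x' y' : α} (hxy : x ≠ y) (hxy' : x' ≠ y') : P x y = P x' y' := by
  obtain ⟨σ, rfl, rfl⟩ := MulAction.is_two_pretransitive_iff.1
    (Equiv.Perm.isMultiplyPretransitive α 2) hxy hxy'
  exact (hP σ x y).symm

section Slice

variable {α : Type*} [Fintype α] {k : ℕ}

lemma expect_powersetCard_ite_mem [DecidableEq α] (hk : k ≤ Fintype.card α) (x : α) :
    𝔼 A ∈ powersetCard k univ, (if x ∈ A then (1 : ℝ) else 0) = k / Fintype.card α := by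
  have h_const (y : α) : 𝔼 A ∈ powersetCard k univ, (if y ∈ A then (1 : ℝ) else 0) =
      𝔼 A ∈ powersetCard k univ, (if x ∈ A then (1 : ℝ) else 0) := by
    rw [← expect_powersetCard_map k (Equiv.swap x y)]
    simp [mem_map_equiv]
  have h_nonempty : (powersetCard k (univ : Finset α)).Nonempty := powersetCard_nonempty.2 hk
  have h_sum : ∑ y : α, 𝔼 A ∈ powersetCard k univ, (if y ∈ A then (1 : ℝ) else 0) = k := by
    rw [← expect_sum_comm, ← expect_const h_nonempty (k : ℝ)]
    refine expect_congr rfl fun A hA => ?_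
    rw [sum_boole, filter_univ_mem, (mem_powersetCard.1 hA).2]
  rw [sum_congr rfl fun y _ => h_const y, sum_const, card_univ, nsmul_eq_mul] at h_sum
  have h_card : (Fintype.card α : ℝ) ≠ 0 := Nat.cast_ne_zero.2 (Fintype.card_pos_iff.2 ⟨x⟩).ne'
  rw [eq_div_iff h_card, mul_comm, h_sum]

lemma expect_powersetCard_sum (hk : k ≤ Fintype.card α) (g : α → ℝ) :
    𝔼 A ∈ powersetCard k univ, ∑ x ∈ A, g x = k * 𝔼 x, g x := by
  classical
  calc 𝔼 A ∈ powersetCard k univ, ∑ x ∈ A, g x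
      = 𝔼 A ∈ powersetCard k univ, ∑ x, g x * (if x ∈ A then 1 else 0) := by
        simp only [mul_ite, mul_one, mul_zero, sum_ite_mem, univ_inter]
    _ = ∑ x, g x * (k / Fintype.card α) := by
        simp only [expect_sum_comm, ← mul_expect, expect_powersetCard_ite_mem hk]
    _ = k * 𝔼 x, g x := by
        rw [← sum_mul, Fintype.expect_eq_sum_div_card]
        ring

lemma sum_sum_mul_le_of_perm_invariant {P : α → α → ℝ} (hP₀ : ∀ x y, 0 ≤ P x y)
    (hP : ∀ (σ : Equiv.Perm α) x y, P (σ x) (σ y) = P x y) {g : α → ℝ} (hg : ∑ x, g x = 0) :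
    ∑ x, ∑ y, g x * g y * P x y ≤ ∑ x, P x x * g x ^ 2 := by
  classical
  obtain ⟨p, hp₀, hp⟩ : ∃ p, 0 ≤ p ∧ ∀ x y, x ≠ y → P x y = p := by
    by_cases h : ∃ x y : α, x ≠ y
    · obtain ⟨x, y, hxy⟩ := h
      exact ⟨P x y, hP₀ x y, fun _ _ h => eq_of_perm_invariant hP h hxy⟩
    · exact ⟨0, le_rfl, fun x y hxy => absurd ⟨x, y, hxy⟩ h⟩
  have h_split (x y : α) : g x * g y * P x y =
      p * g x * g y + if x = y then (P x x - p) * g x ^ 2 else 0 := by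
    split_ifs with hxy
    · rw [← hxy]
      ring
    · rw [hp x y hxy]
      ring
  simp only [h_split, sum_add_distrib, ← mul_sum, hg, mul_zero, zero_add,
    sum_ite_eq, mem_univ, if_true]
  gcongr with x
  linarith

lemma expect_powersetCard_sum_sq_le (hk : k ≤ Fintype.card α) {g : α → ℝ} (hg : ∑ x, g x = 0) :
    𝔼 A ∈ powersetCard k univ, (∑ x ∈ A, g x) ^ 2 ≤ k * 𝔼 x, g x ^ 2 := by
  classical
  let P (x y : α) : ℝ := 𝔼 A ∈ powersetCard k univ, if x ∈ A ∧ y ∈ A then 1 else 0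
  have h_diag (x : α) : P x x = k / Fintype.card α := by
    simp only [P, and_self, expect_powersetCard_ite_mem hk]
  have h_perm (σ : Equiv.Perm α) (x y : α) : P (σ x) (σ y) = P x y := by
    simp only [P]
    rw [← expect_powersetCard_map k σ]
    simp only [mem_map_equiv, Equiv.symm_apply_apply]
  calc 𝔼 A ∈ powersetCard k univ, (∑ x ∈ A, g x) ^ 2
      = ∑ x, ∑ y, g x * g y * P x y := by
        simp only [P, mul_expect, ← expect_sum_comm, sq, sum_mul_sum]
        refine expect_congr rfl fun A _ => ?_
        simp only [ite_and, mul_ite, mul_one, mul_zero, sum_ite_mem, univ_inter, sum_ite_irrel,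
          sum_const_zero]
    _ ≤ ∑ x, P x x * g x ^ 2 :=
        sum_sum_mul_le_of_perm_invariant
          (fun x y => expect_nonneg fun A _ => by positivity) h_perm hg
    _ = k * 𝔼 x, g x ^ 2 := by
        simp only [h_diag, ← mul_sum, Fintype.expect_eq_sum_div_card]
        ring

theorem expect_exp_iSup_sub_le {ι : Type*} [Finite ι] [Nonempty ι] (hk : k ≤ Fintype.card α)
    (a : ι → ℝ) (q : ι → α → ℝ) :
    𝔼 A ∈ powersetCard k univ,
      exp (((⨆ j, (a j + ∑ x ∈ A, q j x - (∑ x ∈ A, q j x ^ 2 + k * 𝔼 x, q j x ^ 2))) -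
        𝔼 B ∈ powersetCard k univ, ⨆ j, (a j + ∑ x ∈ B, q j x)) / 2) ≤ 1 := by
  have h_nonempty : (powersetCard k (univ : Finset α)).Nonempty := powersetCard_nonempty.2 hk
  refine (expect_le_expect fun A _ => ?_).trans (expect_expect_exp_pairGap_le hk a q)
  refine le_trans (exp_le_exp.2 ?_) (exp_expect_le h_nonempty _)
  rw [← expect_div]
  gcongr
  simp only [pairGap, expect_sub_distrib]
  gcongr
  refine le_trans (le_of_eq ?_) (iSup_expect_le _ _)
  simp only [expect_sub_distrib, expect_add_distrib, expect_const h_nonempty,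
    expect_powersetCard_sum hk]

end Slice

section SliceProb

variable {α : Type*} [Fintype α] {k : ℕ}

open Classical in
/-- Probability of `E A` for `A` drawn uniformly among the `k`-element subsets of a finite type.
The sampling probability `prob m u` is `sliceProb u` on `Fin (m + u)`. -/
noncomputable def sliceProb (k : ℕ) (E : Finset α → Prop) : ℝ :=
  (#{A ∈ powersetCard k univ | E A} : ℝ) / #(powersetCard k (univ : Finset α))

open Classical in
lemma sliceProb_eq_expect (k : ℕ) (E : Finset α → Prop) :
    sliceProb k E = 𝔼 A ∈ powersetCard k univ, if E A then 1 else 0 := by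
  rw [sliceProb, expect_eq_sum_div_card, sum_boole]

lemma sliceProb_le_expect {E : Finset α → Prop} {F : Finset α → ℝ} (hF : ∀ A, 0 ≤ F A)
    (hE : ∀ A, E A → 1 ≤ F A) : sliceProb k E ≤ 𝔼 A ∈ powersetCard k univ, F A := by
  rw [sliceProb_eq_expect]
  refine expect_le_expect fun A _ => ?_
  split_ifs with hA
  · exact hE A hA
  · exact hF A

lemma sliceProb_mono {E E' : Finset α → Prop} (h : ∀ A, #A = k → E A → E' A) :
    sliceProb k E ≤ sliceProb k E' := by
  classical
  unfold sliceProb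
  gcongr with A hA
  exact h A (mem_powersetCard.1 hA).2

lemma sliceProb_not (hk : k ≤ Fintype.card α) (E : Finset α → Prop) :
    sliceProb k (fun A => ¬E A) = 1 - sliceProb k E := by
  rw [eq_sub_iff_add_eq, sliceProb, sliceProb, ← add_div, ← Nat.cast_add, add_comm,
    card_filter_add_card_filter_not, div_self]
  exact Nat.cast_ne_zero.2 (powersetCard_nonempty.2 hk).card_ne_zero

lemma expect_powersetCard_compl [DecidableEq α] {l : ℕ} (hkl : k + l = Fintype.card α)
    (F : Finset α → ℝ) :
    𝔼 A ∈ powersetCard k univ, F Aᶜ = 𝔼 A ∈ powersetCard l univ, F A := by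
  refine expect_nbij' (·ᶜ) (·ᶜ) ?_ ?_ (by simp) (by simp) (by simp) <;>
    simp only [mem_powersetCard_univ, card_compl] <;> intros <;> lia

lemma sliceProb_compl [DecidableEq α] {l : ℕ} (hkl : k + l = Fintype.card α)
    (E : Finset α → Prop) : sliceProb k (fun A => E Aᶜ) = sliceProb l E := by
  classical
  rw [sliceProb_eq_expect, sliceProb_eq_expect, ← expect_powersetCard_compl hkl]

theorem sliceProb_exists_lt_le {ι : Type*} [Finite ι] [Nonempty ι] (hk : k ≤ Fintype.card α)
    (a : ι → ℝ) (q : ι → α → ℝ) {b : ℝ}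
    (hb : 𝔼 A ∈ powersetCard k univ, ⨆ j, (a j + ∑ x ∈ A, q j x) ≤ b) (t : ℝ) :
    sliceProb k (fun A => ∃ j, b + 2 * t <
      a j + ∑ x ∈ A, q j x - (∑ x ∈ A, q j x ^ 2 + k * 𝔼 x, q j x ^ 2)) ≤ exp (-t) := by
  let V (A : Finset α) : ℝ :=
    ⨆ j, (a j + ∑ x ∈ A, q j x - (∑ x ∈ A, q j x ^ 2 + k * 𝔼 x, q j x ^ 2))
  let b₀ : ℝ := 𝔼 A ∈ powersetCard k univ, ⨆ j, (a j + ∑ x ∈ A, q j x)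
  calc sliceProb k (fun A => ∃ j, b + 2 * t <
        a j + ∑ x ∈ A, q j x - (∑ x ∈ A, q j x ^ 2 + k * 𝔼 x, q j x ^ 2))
      ≤ 𝔼 A ∈ powersetCard k univ, exp (-t) * exp ((V A - b₀) / 2) := by
        refine sliceProb_le_expect (fun A => by positivity) ?_
        rintro A ⟨j, hj⟩
        have hjV : _ ≤ V A := le_iSup_of_finite (fun j => a j + ∑ x ∈ A, q j x -
          (∑ x ∈ A, q j x ^ 2 + k * 𝔼 x, q j x ^ 2)) j
        rw [← exp_add, one_le_exp_iff]
        linarith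
    _ = exp (-t) * 𝔼 A ∈ powersetCard k univ, exp ((V A - b₀) / 2) := by rw [mul_expect]
    _ ≤ exp (-t) := mul_le_of_le_one_right (exp_nonneg _) (expect_exp_iSup_sub_le hk a q)

end SliceProb

section RuPlus

variable {n k : ℕ}

lemma avg_eq_expect (A : Finset (Fin n)) (g : Fin n → ℝ) : avg A g = 𝔼 i ∈ A, g i :=
  (expect_eq_sum_div_card A g).symm

lemma fullAvg_eq_expect (g : Fin n → ℝ) : fullAvg g = 𝔼 i, g i := by
  rw [Fintype.expect_eq_sum_div_card, Fintype.card_fin, fullAvg]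

lemma fullAvg_sq_nonneg (g : Fin n → ℝ) : 0 ≤ fullAvg (fun i => g i ^ 2) := by
  rw [fullAvg_eq_expect]
  exact expect_nonneg fun i _ => sq_nonneg _

lemma sum_eq_card_mul_avg (A : Finset (Fin n)) (g : Fin n → ℝ) :
    ∑ i ∈ A, g i = #A * avg A g := by
  rw [avg_eq_expect, card_mul_expect]

lemma card_mul_RuPlus (A : Finset (Fin n)) (g : Fin n → ℝ) :
    #A * RuPlus A g = ∑ i ∈ A, g i - #A * fullAvg g := by
  rw [RuPlus, mul_sub, sum_eq_card_mul_avg]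

lemma RuPlus_neg (A : Finset (Fin n)) (g : Fin n → ℝ) : RuPlus A (-g) = -RuPlus A g := by
  simp only [RuPlus, avg_eq_expect, fullAvg_eq_expect, Pi.neg_apply, expect_neg_distrib]
  ring

/-- The process `w (l g + 4 l² g²)` to which the comparison of `A` with an independent copy is
applied in order to control `w (𝔼 i ∈ A, g i)`. When `4 l |g| ≤ 1`, the second term majorizes its
square. -/
noncomputable def tilt (w l : ℝ) (g : Fin n → ℝ) (i : Fin n) : ℝ :=
  w * (l * g i + 4 * l ^ 2 * g i ^ 2)

lemma sq_tilt_le {w l M : ℝ} {g : Fin n → ℝ} {i : Fin n} (hw₀ : 0 ≤ w) (hw₁ : w ≤ 1)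
    (hl : 0 ≤ l) (hlM : 4 * l * M ≤ 1) (hg : |g i| ≤ M) :
    tilt w l g i ^ 2 ≤ 4 * l ^ 2 * w * g i ^ 2 := by
  have h_abs : |4 * l * g i| ≤ 1 := by
    rw [abs_mul, abs_of_nonneg (by positivity)]
    exact (mul_le_mul_of_nonneg_left hg (by positivity)).trans hlM
  have h_factor : (1 + 4 * l * g i) ^ 2 ≤ 2 ^ 2 :=
    sq_le_sq' (by linarith [(abs_le.1 h_abs).1]) (by linarith [(abs_le.1 h_abs).2])
  calc tilt w l g i ^ 2 = (w * w) * (1 + 4 * l * g i) ^ 2 * (l * g i) ^ 2 := by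
        rw [tilt]
        ring
    _ ≤ (w * 1) * 2 ^ 2 * (l * g i) ^ 2 := by gcongr
    _ = 4 * l ^ 2 * w * g i ^ 2 := by ring

lemma sum_tilt (w l : ℝ) (g : Fin n → ℝ) (A : Finset (Fin n)) :
    ∑ i ∈ A, tilt w l g i = w * l * ∑ i ∈ A, g i + 4 * l ^ 2 * w * ∑ i ∈ A, g i ^ 2 := by
  simp only [tilt, mul_add, sum_add_distrib, mul_sum]
  congr 1 <;> exact sum_congr rfl fun i _ => by ring

lemma expect_iSup_sum_tilt_le {ι : Type*} [Finite ι] [Nonempty ι] (hkn : k ≤ n)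
    {g : ι → Fin n → ℝ} {w : ι → ℝ} {l r D₁ D₂ : ℝ} (hl : 0 ≤ l)
    (hwr : ∀ j, w j * fullAvg (fun i => g j i ^ 2) ≤ r)
    (hD₁ : 𝔼 A ∈ powersetCard k univ, ⨆ j, w j * RuPlus A (g j) ≤ D₁)
    (hD₂ : 𝔼 A ∈ powersetCard k univ, ⨆ j, w j * RuPlus A (fun i => g j i ^ 2) ≤ D₂) :
    𝔼 A ∈ powersetCard k univ,
        ⨆ j, (-(k * (w j * l * fullAvg (g j))) + ∑ i ∈ A, tilt (w j) l (g j) i) ≤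
      k * l * (D₁ + 4 * l * D₂ + 4 * l * r) := by
  have h_nonempty : (powersetCard k (univ : Finset (Fin n))).Nonempty :=
    powersetCard_nonempty.2 (by simpa using hkn)
  calc 𝔼 A ∈ powersetCard k univ,
        ⨆ j, (-(k * (w j * l * fullAvg (g j))) + ∑ i ∈ A, tilt (w j) l (g j) i)
      ≤ 𝔼 A ∈ powersetCard k univ, k * l * ((⨆ j, w j * RuPlus A (g j)) +
          4 * l * (⨆ j, w j * RuPlus A (fun i => g j i ^ 2)) + 4 * l * r) := by
        refine expect_le_expect fun A hA => ciSup_le fun j => ?_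
        obtain rfl : #A = k := (mem_powersetCard.1 hA).2
        calc -(#A * (w j * l * fullAvg (g j))) + ∑ i ∈ A, tilt (w j) l (g j) i
            = #A * l * (w j * RuPlus A (g j) + 4 * l * (w j * RuPlus A (fun i => g j i ^ 2)) +
                4 * l * (w j * fullAvg (fun i => g j i ^ 2))) := by
              rw [sum_tilt, sum_eq_card_mul_avg, sum_eq_card_mul_avg, RuPlus, RuPlus]
              ring
          _ ≤ _ := by
              gcongr
              · exact le_iSup_of_finite (fun j => w j * RuPlus A (g j)) j
              · exact le_iSup_of_finite (fun j => w j * RuPlus A (fun i => g j i ^ 2)) j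
              · exact hwr j
    _ = k * l * (𝔼 A ∈ powersetCard k univ, (⨆ j, w j * RuPlus A (g j)) +
          4 * l * 𝔼 A ∈ powersetCard k univ, (⨆ j, w j * RuPlus A (fun i => g j i ^ 2)) +
          4 * l * r) := by
        rw [← mul_expect, expect_add_distrib, expect_add_distrib, ← mul_expect,
          expect_const h_nonempty]
    _ ≤ k * l * (D₁ + 4 * l * D₂ + 4 * l * r) := by gcongr

lemma le_sum_tilt_sub {w l M r : ℝ} {g : Fin n → ℝ} (hw₀ : 0 ≤ w) (hw₁ : w ≤ 1) (hl : 0 ≤ l)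
    (hlM : 4 * l * M ≤ 1) (hg : ∀ i, |g i| ≤ M) (hwr : w * fullAvg (fun i => g i ^ 2) ≤ r)
    (A : Finset (Fin n)) :
    #A * l * (w * RuPlus A g - 4 * l * r) ≤
      -(#A * (w * l * fullAvg g)) + ∑ i ∈ A, tilt w l g i -
        (∑ i ∈ A, tilt w l g i ^ 2 + #A * 𝔼 i, tilt w l g i ^ 2) := by
  have h_sq (i : Fin n) := sq_tilt_le hw₀ hw₁ hl hlM (hg i)
  have h_sum : ∑ i ∈ A, tilt w l g i ^ 2 ≤ 4 * l ^ 2 * w * ∑ i ∈ A, g i ^ 2 := by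
    rw [mul_sum]
    exact sum_le_sum fun i _ => h_sq i
  have h_expect : 𝔼 i, tilt w l g i ^ 2 ≤ 4 * l ^ 2 * r := by
    calc 𝔼 i, tilt w l g i ^ 2 ≤ 𝔼 i, 4 * l ^ 2 * w * g i ^ 2 := expect_le_expect fun i _ => h_sq i
      _ = 4 * l ^ 2 * (w * fullAvg (fun i => g i ^ 2)) := by
        rw [← mul_expect, fullAvg_eq_expect, mul_assoc _ w]
      _ ≤ 4 * l ^ 2 * r := by gcongr
  calc #A * l * (w * RuPlus A g - 4 * l * r)
      = w * l * (∑ i ∈ A, g i - #A * fullAvg g) - #A * (4 * l ^ 2 * r) := by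
        rw [← card_mul_RuPlus]
        ring
    _ ≤ w * l * (∑ i ∈ A, g i - #A * fullAvg g) - #A * 𝔼 i, tilt w l g i ^ 2 := by gcongr
    _ ≤ _ := by
        rw [sum_tilt]
        linarith

theorem sliceProb_exists_lt_RuPlus_le {ι : Type*} [Finite ι] [Nonempty ι] (hk : 0 < k)
    (hkn : k ≤ n) {g : ι → Fin n → ℝ} {w : ι → ℝ} {M l r D₁ D₂ : ℝ} (hg : ∀ j i, |g j i| ≤ M)
    (hw₀ : ∀ j, 0 < w j) (hw₁ : ∀ j, w j ≤ 1)
    (hwr : ∀ j, w j * fullAvg (fun i => g j i ^ 2) ≤ r) (hl : 0 < l) (hlM : 4 * l * M ≤ 1)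
    (hD₁ : 𝔼 A ∈ powersetCard k univ, ⨆ j, w j * RuPlus A (g j) ≤ D₁)
    (hD₂ : 𝔼 A ∈ powersetCard k univ, ⨆ j, w j * RuPlus A (fun i => g j i ^ 2) ≤ D₂) (x : ℝ) :
    sliceProb k (fun A => ∃ j,
      (D₁ + 4 * l * D₂ + 8 * l * r + 2 * x / (k * l)) / w j < RuPlus A (g j)) ≤ exp (-x) := by
  refine (sliceProb_mono fun A hA => ?_).trans (sliceProb_exists_lt_le (by simpa using hkn) _ _
    (expect_iSup_sum_tilt_le hkn hl.le hwr hD₁ hD₂) x)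
  rintro ⟨j, hj⟩
  have h_tilt := le_sum_tilt_sub (hw₀ j).le (hw₁ j) hl.le hlM (hg j) (hwr j) A
  rw [hA] at h_tilt
  refine ⟨j, lt_of_lt_of_le ?_ h_tilt⟩
  rw [div_lt_iff₀' (hw₀ j)] at hj
  have : (0 : ℝ) < k := Nat.cast_pos.2 hk
  calc k * l * (D₁ + 4 * l * D₂ + 4 * l * r) + 2 * x
      = k * l * (D₁ + 4 * l * D₂ + 8 * l * r + 2 * x / (k * l) - 4 * l * r) := by
        field_simp
        ring
    _ < k * l * (w j * RuPlus A (g j) - 4 * l * r) := by gcongr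

end RuPlus

section SubRoot

lemma exists_eq_of_monotoneOn_Icc {α : Type*} [ConditionallyCompleteLattice α] {f : α → α}
    {a b : α} (hab : a ≤ b) (hf : MonotoneOn f (Set.Icc a b)) (ha : a ≤ f a) (hb : f b ≤ b) :
    ∃ t ∈ Set.Icc a b, f t = t := by
  have : Fact (a ≤ b) := ⟨hab⟩
  have h_maps : Set.MapsTo f (Set.Icc a b) (Set.Icc a b) := fun t ht =>
    ⟨ha.trans (hf (Set.left_mem_Icc.2 hab) ht ht.1),
      (hf ht (Set.right_mem_Icc.2 hab) ht.2).trans hb⟩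
  let F : Set.Icc a b →o Set.Icc a b := ⟨h_maps.restrict, fun s t hst => hf s.2 t.2 hst⟩
  exact ⟨F.lfp, F.lfp.2, congrArg Subtype.val F.map_lfp⟩

lemma IsSubRoot.le_div_sqrt_mul_sqrt {ψ : ℝ → ℝ} (hψ : IsSubRoot ψ) {r t : ℝ} (hr : 0 < r)
    (hrt : r ≤ t) : ψ t ≤ ψ r / √r * √t := by
  rw [← div_le_iff₀ (sqrt_pos.2 (hr.trans_le hrt))]
  exact hψ.anti hr (hr.trans_le hrt) hrt

lemma IsSubRoot.div_sqrt_mul_sqrt_le {ψ : ℝ → ℝ} (hψ : IsSubRoot ψ) {r t : ℝ} (ht : 0 < t)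
    (htr : t ≤ r) : ψ r / √r * √t ≤ ψ t := by
  rw [← le_div_iff₀ (sqrt_pos.2 ht)]
  exact hψ.anti ht (ht.trans_le htr) htr

lemma IsSubRoot.exists_eq_self {ψ : ℝ → ℝ} (hψ : IsSubRoot ψ) {r : ℝ} (hr : 0 < r)
    (hψr : 0 < ψ r) : ∃ t, min r ((ψ r / √r) ^ 2) ≤ t ∧ ψ t = t := by
  let c : ℝ := ψ r / √r
  have hc : 0 < c := div_pos hψr (sqrt_pos.2 hr)
  have h_pos : 0 < min r (c ^ 2) := lt_min hr (by positivity)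
  have h_lower : min r (c ^ 2) ≤ ψ (min r (c ^ 2)) := by
    refine le_trans ?_ (hψ.div_sqrt_mul_sqrt_le h_pos (min_le_left _ _))
    nth_rw 1 [← mul_self_sqrt h_pos.le]
    gcongr
    exact sqrt_le_iff.2 ⟨hc.le, min_le_right _ _⟩
  have h_upper : ψ (max r (c ^ 2)) ≤ max r (c ^ 2) := by
    refine (hψ.le_div_sqrt_mul_sqrt hr (le_max_left _ _)).trans ?_
    nth_rw 2 [← mul_self_sqrt (hr.le.trans (le_max_left r (c ^ 2)))]
    gcongr
    exact le_sqrt_of_sq_le (le_max_right _ _)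
  obtain ⟨t, ht, ht_eq⟩ := exists_eq_of_monotoneOn_Icc min_le_max
    (hψ.mono.mono fun t ht => h_pos.le.trans ht.1) h_lower h_upper
  exact ⟨t, ht.1, ht_eq⟩

lemma IsSubRoot.le_sqrt_mul {ψ : ℝ → ℝ} (hψ : IsSubRoot ψ) {s r : ℝ} (hs : IsFixedPointOf ψ s)
    (hr : 0 < r) (hsr : s ≤ r) : ψ r ≤ √(r * s) := by
  rcases le_or_gt (ψ r) 0 with h_nonpos | h_pos
  · exact h_nonpos.trans (sqrt_nonneg _)
  obtain ⟨t, h_min, ht⟩ := hψ.exists_eq_self hr h_pos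
  have h_nonneg : 0 ≤ t := (le_min hr.le (sq_nonneg _)).trans h_min
  rcases min_le_iff.1 (h_min.trans (hs.2 ⟨h_nonneg, ht⟩)) with hrs | hcs
  · obtain rfl : s = r := hsr.antisymm hrs
    rw [hs.1.2, sqrt_mul_self hr.le]
  · refine le_sqrt_of_sq_le ?_
    rwa [div_pow, sq_sqrt hr.le, div_le_iff₀' hr] at hcs

lemma IsSubRoot.four_pow_mul_le {ψ : ℝ → ℝ} (hψ : IsSubRoot ψ) {s r P : ℝ}
    (hs : IsFixedPointOf ψ s) (hr : 0 < r) (hP : 1 ≤ P) (hsr : P ^ 2 * s ≤ r) (p : ℕ) :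
    ψ (4 ^ p * r) ≤ 2 ^ p * (r / P) := by
  have h_four : (4 : ℝ) ^ p = (2 ^ p) ^ 2 := by
    rw [← pow_mul, mul_comm, pow_mul]
    norm_num
  have h_shell : s ≤ 4 ^ p * r :=
    calc s ≤ P ^ 2 * s := le_mul_of_one_le_left hs.1.1 (one_le_pow₀ hP)
      _ ≤ r := hsr
      _ ≤ 4 ^ p * r := le_mul_of_one_le_left hr.le (one_le_pow₀ (by norm_num))
  refine (hψ.le_sqrt_mul hs (by positivity) h_shell).trans (sqrt_le_iff.2 ⟨by positivity, ?_⟩)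
  calc 4 ^ p * r * s ≤ 4 ^ p * r * (r / P ^ 2) := by
        gcongr
        rwa [le_div_iff₀' (by positivity)]
    _ = (2 ^ p * (r / P)) ^ 2 := by
        rw [h_four]
        ring

end SubRoot

section Peeling

lemma exists_le_four_pow_mul {T r : ℝ} (hT : 0 ≤ T) (hr : 0 < r) :
    ∃ p : ℕ, T ≤ 4 ^ p * r ∧ (4 : ℝ) ^ p ≤ 1 + 4 * T / r := by
  rcases le_total T r with hTr | hrT
  · exact ⟨0, by simpa using hTr, by simpa using by positivity⟩
  · obtain ⟨p, hp_le, hp_lt⟩ :=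
      exists_nat_pow_near ((one_le_div hr).2 hrT) (by norm_num : (1 : ℝ) < 4)
    refine ⟨p + 1, ((div_lt_iff₀ hr).1 hp_lt).le, ?_⟩
    rw [pow_succ', mul_div_assoc]
    linarith

lemma expect_iSup_quarter_pow_mul_le {ι β : Type*} [Finite ι] [Nonempty ι] {s : Finset β}
    {F : ι → β → ℝ} {S : ℕ → β → ℝ} {p : ι → ℕ} {d : ℝ} (hS₀ : ∀ m, ∀ b ∈ s, 0 ≤ S m b)
    (hS : ∀ m, 𝔼 b ∈ s, S m b ≤ 2 ^ m * d) (hF : ∀ i, ∀ b ∈ s, F i b ≤ S (p i) b) :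
    𝔼 b ∈ s, ⨆ i, (1 / 4 : ℝ) ^ p i * F i b ≤ 2 * d := by
  obtain ⟨N, hN⟩ := (Set.finite_range p).bddAbove
  have hd : 0 ≤ d := by
    simpa using (expect_nonneg (hS₀ 0)).trans (hS 0)
  calc 𝔼 b ∈ s, ⨆ i, (1 / 4 : ℝ) ^ p i * F i b
      ≤ 𝔼 b ∈ s, ∑ m ∈ range (N + 1), (1 / 4 : ℝ) ^ m * S m b := by
        refine expect_le_expect fun b hb => ciSup_le fun i => ?_
        calc (1 / 4 : ℝ) ^ p i * F i b ≤ (1 / 4 : ℝ) ^ p i * S (p i) b := by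
              gcongr
              exact hF i b hb
          _ ≤ ∑ m ∈ range (N + 1), (1 / 4 : ℝ) ^ m * S m b :=
              single_le_sum (f := fun m => (1 / 4 : ℝ) ^ m * S m b)
                (fun m _ => mul_nonneg (by positivity) (hS₀ m b hb))
                (mem_range_succ_iff.2 (hN ⟨i, rfl⟩))
    _ = ∑ m ∈ range (N + 1), (1 / 4 : ℝ) ^ m * 𝔼 b ∈ s, S m b := by
        simp only [expect_sum_comm, mul_expect]
    _ ≤ ∑ m ∈ range (N + 1), (1 / 4 : ℝ) ^ m * (2 ^ m * d) := by
        gcongr with m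
        exact hS m
    _ = (∑ m ∈ range (N + 1), (1 / 2 : ℝ) ^ m) * d := by
        rw [sum_mul]
        refine sum_congr rfl fun m _ => ?_
        rw [← mul_assoc, ← mul_pow]
        norm_num
    _ ≤ 2 * d := by
        gcongr
        exact sum_geometric_two_le _

lemma expect_max_iSup_zero_le {J β : Type*} {s : Finset β} {φ : J → β → ℝ} {d₁ d₂ : ℝ}
    (h_bdd : ∀ b ∈ s, BddAbove (Set.range fun j => φ j b)) (hd : 0 ≤ d₁ + d₂)
    (h_sup : 𝔼 b ∈ s, ⨆ j, φ j b ≤ d₁) (h_pivot : Nonempty J → ∃ j, 𝔼 b ∈ s, |φ j b| ≤ d₂) :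
    𝔼 b ∈ s, max (⨆ j, φ j b) 0 ≤ d₁ + d₂ := by
  rcases isEmpty_or_nonempty J with hJ | hJ
  · simpa only [iSup_of_isEmpty, max_self, expect_const_zero] using hd
  · obtain ⟨j, hj⟩ := h_pivot hJ
    calc 𝔼 b ∈ s, max (⨆ j, φ j b) 0 ≤ 𝔼 b ∈ s, ((⨆ j, φ j b) + |φ j b|) := by
          refine expect_le_expect fun b hb => ?_
          have h_le : φ j b ≤ ⨆ j, φ j b := le_ciSup (h_bdd b hb) j
          exact max_le (by linarith [abs_nonneg (φ j b)]) (by linarith [neg_abs_le (φ j b)])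
      _ ≤ d₁ + d₂ := by
          rw [expect_add_distrib]
          gcongr

end Peeling

section Localization

variable {n k : ℕ}

lemma expect_RuPlus_sq_le (hk : 0 < k) (hkn : k ≤ n) (g : Fin n → ℝ) :
    𝔼 A ∈ powersetCard k univ, RuPlus A g ^ 2 ≤ fullAvg (fun i => g i ^ 2) / k := by
  have hk' : (0 : ℝ) < k := Nat.cast_pos.2 hk
  have : Nonempty (Fin n) := ⟨⟨0, hk.trans_le hkn⟩⟩
  let c : Fin n → ℝ := fun i => g i - fullAvg g
  have h_card : (n : ℝ) * fullAvg g = ∑ i, g i := by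
    simpa only [card_univ, Fintype.card_fin, fullAvg_eq_expect] using card_mul_expect univ g
  have h_sum : ∑ i, c i = 0 := by
    simp only [c, sum_sub_distrib, sum_const, card_univ, Fintype.card_fin, nsmul_eq_mul, h_card,
      sub_self]
  have h_sq : 𝔼 i, c i ^ 2 ≤ fullAvg (fun i => g i ^ 2) :=
    calc 𝔼 i, c i ^ 2 = fullAvg (fun i => g i ^ 2) - fullAvg g ^ 2 := by
          simp only [c, sub_sq, expect_add_distrib, expect_sub_distrib, ← mul_expect,
            ← expect_mul, ← fullAvg_eq_expect, Fintype.expect_const]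
          ring
      _ ≤ fullAvg (fun i => g i ^ 2) := sub_le_self _ (sq_nonneg _)
  calc 𝔼 A ∈ powersetCard k univ, RuPlus A g ^ 2
      = 𝔼 A ∈ powersetCard k univ, (1 / k ^ 2) * (∑ i ∈ A, c i) ^ 2 := by
        refine expect_congr rfl fun A hA => ?_
        obtain rfl : #A = k := (mem_powersetCard.1 hA).2
        rw [sum_sub_distrib, sum_const, nsmul_eq_mul, ← card_mul_RuPlus]
        field_simp
    _ ≤ (1 / k ^ 2) * (k * fullAvg (fun i => g i ^ 2)) := by
        rw [← mul_expect]
        gcongr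
        refine (expect_powersetCard_sum_sq_le (by simpa using hkn) h_sum).trans ?_
        gcongr
    _ = fullAvg (fun i => g i ^ 2) / k := by
        field_simp

lemma expect_abs_RuPlus_le (hk : 0 < k) (hkn : k ≤ n) {g : Fin n → ℝ} {d : ℝ} (hd : 0 ≤ d)
    (hg : fullAvg (fun i => g i ^ 2) / k ≤ d ^ 2) :
    𝔼 A ∈ powersetCard k univ, |RuPlus A g| ≤ d :=
  (expect_abs_le_sqrt _ _).trans
    (sqrt_le_iff.2 ⟨hd, (expect_RuPlus_sq_le hk hkn g).trans hg⟩)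

lemma RuPlus_zero (A : Finset (Fin n)) : RuPlus A 0 = 0 := by
  simp [RuPlus, avg, fullAvg]

lemma exists_expect_abs_RuPlus_le {J : Type*} (hk : 0 < k) (hkn : k ≤ n) {g : J → Fin n → ℝ}
    {T : J → ℝ} {v r d : ℝ} (hv : 0 ≤ v) (hr : 0 ≤ r) (hd : 0 ≤ d)
    (hg : ∀ j, fullAvg (fun i => g j i ^ 2) ≤ v * T j)
    (h_pivot : v * r / k ≤ d ^ 2 ∨ ∃ j₀, g j₀ = 0 ∧ T j₀ ≤ r) (p : ℕ) {j : J}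
    (hj : T j ≤ 4 ^ p * r) :
    ∃ j', T j' ≤ 4 ^ p * r ∧ 𝔼 A ∈ powersetCard k univ, |RuPlus A (g j')| ≤ 2 ^ p * d := by
  rcases h_pivot with h_small | ⟨j₀, hg₀, hT₀⟩
  · refine ⟨j, hj, expect_abs_RuPlus_le hk hkn (by positivity) ?_⟩
    calc fullAvg (fun i => g j i ^ 2) / k ≤ v * (4 ^ p * r) / k := by
          gcongr
          exact (hg j).trans (by gcongr)
      _ = 4 ^ p * (v * r / k) := by ring
      _ ≤ 4 ^ p * d ^ 2 := by gcongr
      _ = (2 ^ p * d) ^ 2 := by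
          rw [mul_pow, ← pow_mul, mul_comm p, pow_mul]
          norm_num
  · refine ⟨j₀, hT₀.trans (le_mul_of_one_le_left hr (one_le_pow₀ (by norm_num))), ?_⟩
    simp only [hg₀, RuPlus_zero, abs_zero, expect_const_zero]
    positivity

/-- The expected supremum of `R⁺ g` over the part `{j | T j ≤ r}` of an indexed class, for samples
of size `k`. For `k = u` and `J = H` this is the quantity bounded by `ψ_u`; since `R⁺_m` on the
test set is `R⁺_u` on its complement, `k = m` gives the one bounded by `ψ_m`. -/
noncomputable def localComplexity {J : Type*} (k : ℕ) (g : J → Fin n → ℝ) (T : J → ℝ) (r : ℝ) : ℝ :=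
  𝔼 A ∈ powersetCard k univ, ⨆ j : {j // T j ≤ r}, RuPlus A (g j)

lemma abs_RuPlus_le {A : Finset (Fin n)} {g : Fin n → ℝ} {M : ℝ} (hM : 0 ≤ M)
    (hg : ∀ i, |g i| ≤ M) : |RuPlus A g| ≤ 2 * M := by
  have h_expect (B : Finset (Fin n)) : |𝔼 i ∈ B, g i| ≤ M := by
    rcases B.eq_empty_or_nonempty with rfl | hB
    · simpa using hM
    · exact (abs_expect_le _ _).trans (expect_le hB fun i _ => hg i)
  rw [RuPlus, avg_eq_expect, fullAvg_eq_expect, two_mul]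
  exact (abs_sub _ _).trans (add_le_add (h_expect A) (h_expect univ))

theorem expect_iSup_quarter_pow_mul_RuPlus_le {ι J : Type*} [Finite ι] [Nonempty ι]
    {g : J → Fin n → ℝ} {T : J → ℝ} {M r d : ℝ} (hM : 0 ≤ M) (hd : 0 ≤ d)
    (hg : ∀ j i, |g j i| ≤ M) (h_local : ∀ p : ℕ, localComplexity k g T (4 ^ p * r) ≤ 2 ^ p * d)
    (h_pivot : ∀ (p : ℕ) (j : J), T j ≤ 4 ^ p * r →
      ∃ j', T j' ≤ 4 ^ p * r ∧ 𝔼 A ∈ powersetCard k univ, |RuPlus A (g j')| ≤ 2 ^ p * d)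
    {f : ι → J} {p : ι → ℕ} (hf : ∀ i, T (f i) ≤ 4 ^ p i * r) :
    𝔼 A ∈ powersetCard k univ, ⨆ i, (1 / 4 : ℝ) ^ p i * RuPlus A (g (f i)) ≤ 4 * d := by
  have h_bdd (m : ℕ) (A : Finset (Fin n)) :
      BddAbove (Set.range fun j : {j // T j ≤ 4 ^ m * r} => RuPlus A (g j)) := by
    refine ⟨2 * M, ?_⟩
    rintro _ ⟨j, rfl⟩
    exact (abs_le.1 (abs_RuPlus_le hM (hg j))).2
  refine (expect_iSup_quarter_pow_mul_le (d := 2 * d)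
    (S := fun m A => max (⨆ j : {j // T j ≤ 4 ^ m * r}, RuPlus A (g j)) 0)
    (fun m A _ => le_max_right _ _) (fun m => ?_) (fun i A _ => ?_)).trans_eq (by ring)
  · refine (expect_max_iSup_zero_le (d₂ := 2 ^ m * d) (fun A _ => h_bdd m A)
      (by positivity) (h_local m) fun ⟨j⟩ => ?_).trans_eq (by ring)
    obtain ⟨j', hj', h_abs⟩ := h_pivot m j j.2
    exact ⟨⟨j', hj'⟩, h_abs⟩
  · exact le_max_of_le_left (le_ciSup (h_bdd (p i) A) ⟨f i, hf i⟩)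

end Localization

section LocalizedTail

variable {n k : ℕ} {J : Type*} {q : J → Fin n → ℝ} {T : J → ℝ} {M P r x : ℝ}

lemma sliceProb_exists_le {α : Type*} [Fintype α] [Nonempty J] {E : J → Finset α → Prop} {ε : ℝ}
    (h_family : ∀ f : Finset α → J, sliceProb k (fun A => ∃ B, E (f B) A) ≤ ε) :
    sliceProb k (fun A => ∃ j, E j A) ≤ ε := by
  -- Choosing one violating member for each index set reduces the class to a finite family.
  have h_select (A : Finset α) : ∃ j, (∃ j', E j' A) → E j A := by
    by_cases hA : ∃ j', E j' A
    · exact hA.imp fun _ hj _ => hj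
    · exact ⟨Classical.arbitrary J, fun h => absurd h hA⟩
  choose f hf using h_select
  exact (sliceProb_mono fun A _ hA => ⟨A, hf A hA⟩).trans (h_family f)

lemma threshold_le (hk : 0 < k) (hM : 1 ≤ M) (hP : 2 ≤ P) (hr : 0 < r)
    (hx : P ^ 2 * M ^ 2 * (x / k) ≤ r) {l : ℝ} (hl : l = 1 / (2 * P * M)) :
    4 * (r / P) + 4 * l * (4 * (r / P)) + 8 * l * r + 2 * x / (k * l) ≤ 16 * (r / P) := by
  have : (0 : ℝ) < k := Nat.cast_pos.2 hk
  have h_two : 2 ≤ P * M := hP.trans (le_mul_of_one_le_right (by positivity) hM)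
  have h_square : 4 * l * (4 * (r / P)) ≤ 4 * (r / P) := by
    have hl_le : 4 * l ≤ 1 := by
      rw [hl, mul_one_div, div_le_one (by positivity)]
      linarith
    nlinarith [div_pos hr (by positivity : 0 < P)]
  have h_radius : 8 * l * r ≤ 4 * (r / P) := by
    calc 8 * l * r = 4 * (r / P) / M := by
          rw [hl]
          field_simp
          norm_num
      _ ≤ 4 * (r / P) := div_le_self (by positivity) hM
  have h_deviation : 2 * x / (k * l) ≤ 4 * (r / P) := by
    calc 2 * x / (k * l) = 4 * (P ^ 2 * M ^ 2 * (x / k) / P) / M := by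
          rw [hl]
          field_simp
          ring
      _ ≤ 4 * (r / P) / M := by gcongr
      _ ≤ 4 * (r / P) := div_le_self (by positivity) hM
  linarith

lemma div_quarter_pow_le {b t : ℝ} {p : ℕ} (hP : 0 < P) (hr : 0 < r) (hb : b ≤ 16 * (r / P))
    (hp : (4 : ℝ) ^ p ≤ 1 + 4 * t / r) : b / (1 / 4 : ℝ) ^ p ≤ 64 * (t + r) / P :=
  calc b / (1 / 4 : ℝ) ^ p ≤ 16 * (r / P) / (1 / 4 : ℝ) ^ p := by gcongr
    _ = 16 * (r / P) * 4 ^ p := by rw [one_div, inv_pow, div_inv_eq_mul]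
    _ ≤ 16 * (r / P) * (1 + 4 * t / r) := by gcongr
    _ = (64 * t + 16 * r) / P := by
        field_simp
        ring
    _ ≤ 64 * (t + r) / P := by
        gcongr
        linarith

lemma fullAvg_sq_sq_le {g : Fin n → ℝ} (hg : ∀ i, |g i| ≤ M) :
    fullAvg (fun i => (g i ^ 2) ^ 2) ≤ M ^ 2 * fullAvg (fun i => g i ^ 2) := by
  rw [fullAvg_eq_expect, fullAvg_eq_expect, mul_expect]
  refine expect_le_expect fun i _ => ?_
  rw [sq (g i ^ 2)]
  exact mul_le_mul_of_nonneg_right (sq_le_sq.2 ((hg i).trans (le_abs_self M))) (sq_nonneg _)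

theorem sliceProb_exists_family_lt_RuPlus_le {ι : Type*} [Finite ι] [Nonempty ι] (hk : 0 < k)
    (hkn : k ≤ n) (hM : 1 ≤ M) (hP : 2 ≤ P) (hr : 0 < r) (hx : P ^ 2 * M ^ 2 * (x / k) ≤ r)
    (hq : ∀ j i, |q j i| ≤ M) (hT : ∀ j, fullAvg (fun i => q j i ^ 2) ≤ T j)
    (h_local : ∀ p : ℕ, localComplexity k q T (4 ^ p * r) ≤ 2 ^ p * (r / P))
    (h_local_sq : ∀ p : ℕ,
      localComplexity k (fun j i => q j i ^ 2) T (4 ^ p * r) ≤ 2 ^ p * (r / P))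
    (h_pivot : M ^ 2 * r / k ≤ (r / P) ^ 2 ∨ ∃ j₀, q j₀ = 0 ∧ T j₀ ≤ r) (f : ι → J) :
    sliceProb k (fun A => ∃ i, 64 * (T (f i) + r) / P < RuPlus A (q (f i))) ≤ exp (-x) := by
  have hT₀ (j : J) : 0 ≤ T j := (fullAvg_sq_nonneg (q j)).trans (hT j)
  have hM₀ : 0 ≤ M := zero_le_one.trans hM
  have hrP : 0 ≤ r / P := by positivity
  choose p h_shell h_pow using fun i => exists_le_four_pow_mul (hT₀ (f i)) hr
  have h_pivot_sq : M ^ 2 * r / k ≤ (r / P) ^ 2 ∨ ∃ j₀, (fun i => q j₀ i ^ 2) = 0 ∧ T j₀ ≤ r :=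
    h_pivot.imp_right fun ⟨j₀, hq₀, hj₀⟩ => ⟨j₀, by simp [hq₀, funext_iff], hj₀⟩
  have h_sup := expect_iSup_quarter_pow_mul_RuPlus_le hM₀ hrP hq h_local
    (fun _ _ => exists_expect_abs_RuPlus_le hk hkn (sq_nonneg M) hr.le hrP
      (fun j => (hT j).trans (le_mul_of_one_le_left (hT₀ j) (one_le_pow₀ hM))) h_pivot _) h_shell
  have h_sup_sq := expect_iSup_quarter_pow_mul_RuPlus_le (sq_nonneg M) hrP
    (fun j i => by simpa using sq_le_sq.2 ((hq j i).trans (le_abs_self M))) h_local_sq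
    (fun _ _ => exists_expect_abs_RuPlus_le hk hkn (sq_nonneg M) hr.le hrP
      (fun j => (fullAvg_sq_sq_le (hq j)).trans (by gcongr; exact hT j)) h_pivot_sq _) h_shell
  refine (sliceProb_mono fun A _ => Exists.imp fun i hi => lt_of_le_of_lt ?_ hi).trans
    (sliceProb_exists_lt_RuPlus_le hk hkn (fun i => hq (f i)) (fun i => by positivity)
      (fun i => pow_le_one₀ (by norm_num) (by norm_num)) (r := r) (fun i => ?_)
      (l := 1 / (2 * P * M)) (by positivity) ?_ h_sup h_sup_sq x)
  · exact div_quarter_pow_le (by positivity) hr (threshold_le hk hM hP hr hx rfl) (h_pow i)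
  · rw [one_div, inv_pow, inv_mul_le_iff₀ (by positivity)]
    exact (hT (f i)).trans (h_shell i)
  · rw [mul_one_div, div_mul_eq_mul_div, div_le_one (by positivity)]
    nlinarith

theorem sliceProb_exists_lt_RuPlus_localized_le (hk : 0 < k)
    (hkn : k ≤ n) (hM : 1 ≤ M) (hP : 2 ≤ P) (hr : 0 < r) (hx : P ^ 2 * M ^ 2 * (x / k) ≤ r)
    (hq : ∀ j i, |q j i| ≤ M) (hT : ∀ j, fullAvg (fun i => q j i ^ 2) ≤ T j)
    (h_local : ∀ p : ℕ, localComplexity k q T (4 ^ p * r) ≤ 2 ^ p * (r / P))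
    (h_local_sq : ∀ p : ℕ,
      localComplexity k (fun j i => q j i ^ 2) T (4 ^ p * r) ≤ 2 ^ p * (r / P))
    (h_pivot : M ^ 2 * r / k ≤ (r / P) ^ 2 ∨ ∃ j₀, q j₀ = 0 ∧ T j₀ ≤ r) :
    sliceProb k (fun A => ∃ j, 64 * (T j + r) / P < RuPlus A (q j)) ≤ exp (-x) := by
  rcases isEmpty_or_nonempty J with hJ | hJ
  · simpa [sliceProb] using exp_nonneg (-x)
  · exact sliceProb_exists_le fun f => sliceProb_exists_family_lt_RuPlus_le hk hkn hM hP hr hx hq hT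
      h_local h_local_sq h_pivot f

end LocalizedTail

section OneSided

variable {n k : ℕ} {J : Type*} {q : J → Fin n → ℝ} {T : J → ℝ} {M s ρ x : ℝ} {ψ : ℝ → ℝ}

lemma mul_RuPlus_eq_card_compl_mul (A : Finset (Fin n)) (g : Fin n → ℝ) :
    n * RuPlus A g = #Aᶜ * (avg A g - avg Aᶜ g) := by
  have h_card : (n : ℝ) = #A + #Aᶜ := by
    rw [← Nat.cast_add, card_add_card_compl, Fintype.card_fin]
  have h_sum : (n : ℝ) * fullAvg g = #A * avg A g + #Aᶜ * avg Aᶜ g := by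
    rw [← sum_eq_card_mul_avg, ← sum_eq_card_mul_avg, sum_add_sum_compl, fullAvg_eq_expect]
    simpa using card_mul_expect univ g
  rw [RuPlus, mul_sub, h_sum, h_card]
  ring

lemma avg_le_avg_compl_add {A : Finset (Fin n)} {g : Fin n → ℝ} {y : ℝ} (hn : 0 < n)
    (hA : 2 * #A ≤ n) (hy : 0 ≤ y) (hR : RuPlus A g ≤ y) : avg A g ≤ avg Aᶜ g + 2 * y := by
  have h_card : #A + #Aᶜ = n := by rw [card_add_card_compl, Fintype.card_fin]
  have h_pos : (0 : ℝ) < #Aᶜ := Nat.cast_pos.2 (by lia)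
  have h_half : (n : ℝ) ≤ 2 * #Aᶜ := by exact_mod_cast (by lia : n ≤ 2 * #Aᶜ)
  have h_mul : #Aᶜ * (avg A g - avg Aᶜ g) ≤ #Aᶜ * (2 * y) :=
    calc #Aᶜ * (avg A g - avg Aᶜ g) = n * RuPlus A g := (mul_RuPlus_eq_card_compl_mul A g).symm
      _ ≤ n * y := by gcongr
      _ ≤ 2 * #Aᶜ * y := by gcongr
      _ = #Aᶜ * (2 * y) := by ring
  linarith [le_of_mul_le_mul_left h_mul h_pos]

theorem sliceProb_exists_lt_RuPlus_subRoot_le {P : ℝ} (hk : 0 < k) (hkn : k ≤ n) (hP : 2 ≤ P)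
    (hM : 1 ≤ M) (hq : ∀ j i, |q j i| ≤ M) (hT : ∀ j, fullAvg (fun i => q j i ^ 2) ≤ T j)
    (hψ : IsSubRoot ψ) (hs : IsFixedPointOf ψ s) (hsρ : s ≤ ρ)
    (h_local : ∀ r, s ≤ r → localComplexity k q T r ≤ ψ r)
    (h_local_sq : ∀ r, s ≤ r → localComplexity k (fun j i => q j i ^ 2) T r ≤ ψ r)
    (hx : 0 < x) (hx_pivot : 1 ≤ x ∨ ∃ j₀, q j₀ = 0 ∧ T j₀ ≤ ρ) :
    sliceProb k (fun A => ∃ j, 64 * (T j + P ^ 2 * (ρ + M ^ 2 * (x / k))) / P < RuPlus A (q j)) ≤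
      exp (-x) := by
  have : (0 : ℝ) < k := Nat.cast_pos.2 hk
  have hρ : 0 ≤ ρ := hs.1.1.trans hsρ
  have hP₁ : 1 ≤ P := by linarith
  let r : ℝ := P ^ 2 * (ρ + M ^ 2 * (x / k))
  have hr : 0 < r := by positivity
  have hPρ : P ^ 2 * ρ ≤ r :=
    mul_le_mul_of_nonneg_left (le_add_of_nonneg_right (by positivity)) (by positivity)
  have hρr : ρ ≤ r := (le_mul_of_one_le_left hρ (one_le_pow₀ hP₁)).trans hPρ
  have hxr : P ^ 2 * M ^ 2 * (x / k) ≤ r := by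
    rw [mul_assoc]
    exact mul_le_mul_of_nonneg_left (le_add_of_nonneg_left hρ) (by positivity)
  have h_shell (p : ℕ) : s ≤ 4 ^ p * r :=
    (hsρ.trans hρr).trans (le_mul_of_one_le_left hr.le (one_le_pow₀ (by norm_num)))
  have h_subroot := hψ.four_pow_mul_le hs hr hP₁
    ((mul_le_mul_of_nonneg_left hsρ (by positivity)).trans hPρ)
  have h_pivot : M ^ 2 * r / k ≤ (r / P) ^ 2 ∨ ∃ j₀, q j₀ = 0 ∧ T j₀ ≤ r := by
    refine hx_pivot.imp (fun hx₁ => ?_) fun ⟨j₀, hq₀, hj₀⟩ => ⟨j₀, hq₀, hj₀.trans hρr⟩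
    rw [div_pow, le_div_iff₀ (by positivity)]
    calc M ^ 2 * r / k * P ^ 2 = r * (P ^ 2 * M ^ 2 * (1 / k)) := by ring
      _ ≤ r * (P ^ 2 * M ^ 2 * (x / k)) := by gcongr
      _ ≤ r ^ 2 := by
        rw [sq r]
        gcongr
  exact sliceProb_exists_lt_RuPlus_localized_le hk hkn hM hP hr hxr hq hT
    (fun p => (h_local _ (h_shell p)).trans (h_subroot p))
    (fun p => (h_local_sq _ (h_shell p)).trans (h_subroot p)) h_pivot

theorem one_sub_exp_neg_le_sliceProb {K : ℝ} (hk : 0 < k) (hkn : 2 * k ≤ n) (hK : 0 < K)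
    (hM : 1 ≤ M) (hq : ∀ j i, |q j i| ≤ M) (hT : ∀ j, fullAvg (fun i => q j i ^ 2) ≤ T j)
    (hψ : IsSubRoot ψ) (hs : IsFixedPointOf ψ s) (hsρ : s ≤ ρ)
    (h_local : ∀ r, s ≤ r → localComplexity k q T r ≤ ψ r)
    (h_local_sq : ∀ r, s ≤ r → localComplexity k (fun j i => q j i ^ 2) T r ≤ ψ r)
    (hx : 0 < x) (hx_pivot : 1 ≤ x ∨ ∃ j₀, q j₀ = 0 ∧ T j₀ ≤ ρ) :
    1 - exp (-x) ≤ sliceProb k (fun A => ∀ j, avg A (q j) ≤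
      avg Aᶜ (q j) + (T j / K + 2 ^ 14 * (1 + K) * (ρ + M ^ 2 * (x / k)))) := by
  have hkn' : k ≤ n := by lia
  have hρ : 0 ≤ ρ := hs.1.1.trans hsρ
  have h_tail := sliceProb_exists_lt_RuPlus_subRoot_le (P := 128 * (1 + K)) hk hkn' (by linarith)
    hM hq hT hψ hs hsρ h_local h_local_sq hx hx_pivot
  refine (sub_le_sub_left h_tail 1).trans ?_
  rw [← sliceProb_not (by simpa using hkn')]
  refine sliceProb_mono fun A hA h_good j => ?_
  have hT₀ : 0 ≤ T j := (fullAvg_sq_nonneg (q j)).trans (hT j)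
  push Not at h_good
  refine (avg_le_avg_compl_add (by lia) (by lia) (by positivity) (h_good j)).trans ?_
  gcongr
  calc 2 * (64 * (T j + (128 * (1 + K)) ^ 2 * (ρ + M ^ 2 * (x / k))) / (128 * (1 + K)))
      = T j / (1 + K) + 2 ^ 14 * (1 + K) * (ρ + M ^ 2 * (x / k)) := by
        field_simp
        ring
    _ ≤ T j / K + 2 ^ 14 * (1 + K) * (ρ + M ^ 2 * (x / k)) := by
        gcongr
        linarith

end OneSided

section Transductive

variable {m u : ℕ}

lemma expect_eq_expect_powersetCard (F : Finset (Fin (m + u)) → ℝ) :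
    expect m u F = 𝔼 A ∈ powersetCard u univ, F A :=
  (expect_eq_sum_div_card _ F).symm

lemma iSup_localized {Z : Type*} (H : Set (Z → ℝ)) (T : (Z → ℝ) → ℝ) (r : ℝ)
    (F : (Z → ℝ) → ℝ) :
    ⨆ h : localized H T r, F h = ⨆ h : {h : H // T h ≤ r}, F h :=
  ((Equiv.subtypeSubtypeEquivSubtypeInter (· ∈ H) (T · ≤ r)).iSup_congr fun _ => rfl).symm

lemma localComplexity_test {Z : Type*} (H : Set (Z → ℝ)) (T : (Z → ℝ) → ℝ)
    (g : (Z → ℝ) → Fin (m + u) → ℝ) (r : ℝ) :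
    localComplexity u (fun h : H => g h) (fun h : H => T h) r =
      expect m u fun A => ⨆ h : localized H T r, RuPlus A (g h) := by
  rw [localComplexity, expect_eq_expect_powersetCard]
  exact expect_congr rfl fun A _ => (iSup_localized H T r fun h => RuPlus A (g h)).symm

lemma localComplexity_train {Z : Type*} (H : Set (Z → ℝ)) (T : (Z → ℝ) → ℝ)
    (g : (Z → ℝ) → Fin (m + u) → ℝ) (r : ℝ) :
    localComplexity m (fun h : H => g h) (fun h : H => T h) r =
      expect m u fun A => ⨆ h : localized H T r, RmPlus A (g h) := by
  rw [localComplexity, ← expect_powersetCard_compl (by simp [add_comm] : u + m = _),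
    expect_eq_expect_powersetCard]
  exact expect_congr rfl fun A _ => (iSup_localized H T r fun h => RmPlus A (g h)).symm

lemma avg_neg {n : ℕ} (A : Finset (Fin n)) (g : Fin n → ℝ) : avg A (-g) = -avg A g := by
  simp only [avg_eq_expect, Pi.neg_apply, expect_neg_distrib]

lemma RmPlus_neg {n : ℕ} (A : Finset (Fin n)) (g : Fin n → ℝ) : RmPlus A (-g) = RmMinus A g :=
  RuPlus_neg Aᶜ g

section Class

variable {K H₀ s ρ x : ℝ} {Z : Type*} {z : Fin (m + u) → Z} {H : Set (Z → ℝ)}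
  {T : (Z → ℝ) → ℝ} {ψ : ℝ → ℝ}

theorem one_sub_exp_neg_le_prob_of_test_le_train (hu : 0 < u) (hum : u ≤ m) (hK : 0 < K)
    (hH : ∀ h ∈ H, ∀ i, |h (z i)| ≤ H₀) (hT : ∀ h ∈ H, Tn z h ≤ T h)
    (hψ : IsSubRoot ψ) (hs : IsFixedPointOf ψ s) (hsρ : s ≤ ρ)
    (h_local : ∀ r, s ≤ r →
      max (expect m u fun A => ⨆ h : localized H T r, RuPlus A (onSample z h))
        (expect m u fun A => ⨆ h : localized H T r, RuPlus A (onSampleSq z h)) ≤ ψ r)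
    (hx : 0 < x) (hx_pivot : 1 ≤ x ∨ ∃ h₀ ∈ H, (∀ i, h₀ (z i) = 0) ∧ T h₀ ≤ ρ) :
    1 - exp (-x) ≤ prob m u fun A => ∀ h ∈ H, avg A (onSample z h) ≤ avg Aᶜ (onSample z h) +
      (T h / K + 2 ^ 14 * (1 + K) * (ρ + max 1 H₀ ^ 2 * (x / u))) := by
  refine (one_sub_exp_neg_le_sliceProb (q := fun h : H => onSample z h) (T := fun h : H => T h)
    hu (by lia) hK (le_max_left 1 H₀) (fun h i => (hH h h.2 i).trans (le_max_right _ _))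
    (fun h => hT h h.2) hψ hs hsρ (fun r hr => ?_) (fun r hr => ?_) hx ?_).trans
    (sliceProb_mono fun A _ hA h hh => hA ⟨h, hh⟩)
  · exact (localComplexity_test H T (onSample z) r).trans_le (max_le_iff.1 (h_local r hr)).1
  · exact (localComplexity_test H T (onSampleSq z) r).trans_le (max_le_iff.1 (h_local r hr)).2
  · exact hx_pivot.imp_right fun ⟨h₀, hh₀, hz, hT₀⟩ => ⟨⟨h₀, hh₀⟩, funext hz, hT₀⟩

theorem one_sub_exp_neg_le_prob_of_train_le_test (hm : 0 < m) (hmu : m ≤ u) (hK : 0 < K)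
    (hH : ∀ h ∈ H, ∀ i, |h (z i)| ≤ H₀) (hT : ∀ h ∈ H, Tn z h ≤ T h)
    (hψ : IsSubRoot ψ) (hs : IsFixedPointOf ψ s) (hsρ : s ≤ ρ)
    (h_local : ∀ r, s ≤ r →
      max (expect m u fun A => ⨆ h : localized H T r, RmMinus A (onSample z h))
        (expect m u fun A => ⨆ h : localized H T r, RmPlus A (onSampleSq z h)) ≤ ψ r)
    (hx : 0 < x) (hx_pivot : 1 ≤ x ∨ ∃ h₀ ∈ H, (∀ i, h₀ (z i) = 0) ∧ T h₀ ≤ ρ) :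
    1 - exp (-x) ≤ prob m u fun A => ∀ h ∈ H, avg A (onSample z h) ≤ avg Aᶜ (onSample z h) +
      (T h / K + 2 ^ 14 * (1 + K) * (ρ + max 1 H₀ ^ 2 * (x / m))) := by
  refine (one_sub_exp_neg_le_sliceProb (q := fun h : H => -onSample z h) (T := fun h : H => T h)
    hm (by lia) hK (le_max_left 1 H₀) (fun h i => ?_) (fun h => ?_) hψ hs hsρ (fun r hr => ?_)
    (fun r hr => ?_) hx ?_).trans ?_
  · exact (abs_neg _).trans_le ((hH h h.2 i).trans (le_max_right _ _))
  · simp only [Pi.neg_apply, neg_sq]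
    exact hT h h.2
  · rw [localComplexity_train H T (fun h => -onSample z h)]
    simpa only [RmPlus_neg] using (max_le_iff.1 (h_local r hr)).1
  · simp only [Pi.neg_apply, neg_sq]
    exact (localComplexity_train H T (onSampleSq z) r).trans_le (max_le_iff.1 (h_local r hr)).2
  · exact hx_pivot.imp_right fun ⟨h₀, hh₀, hz, hT₀⟩ =>
      ⟨⟨h₀, hh₀⟩, funext fun i => neg_eq_zero.2 (hz i), hT₀⟩
  · rw [← sliceProb_compl (by simp [add_comm] : u + m = _)]
    refine sliceProb_mono fun A _ hA h hh => ?_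
    have h_neg := hA ⟨h, hh⟩
    simp only [avg_neg, compl_compl] at h_neg
    linarith

end Class

end Transductive

end TLC

open TLC in
theorem mainTheorem3_general {K : ℝ} (hK : 0 < K) {H₀ : ℝ} {m u : ℕ} (hm : 0 < m) (hu : 0 < u)
    {Z : Type*} {z : Fin (m + u) → Z} {H : Set (Z → ℝ)} (hH : ∀ h ∈ H, ∀ i, |h (z i)| ≤ H₀)
    {T : (Z → ℝ) → ℝ} (hT : ∀ h ∈ H, Tn z h ≤ T h) {ψ : ℝ → ℝ} {s ρ : ℝ}
    (hψ : IsSubRoot ψ) (hs : IsFixedPointOf ψ s) (hsρ : s ≤ ρ)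
    (h_local :
      (u ≤ m ∧ ∀ r, s ≤ r →
        max (expect m u fun A => ⨆ h : localized H T r, RuPlus A (onSample z h))
          (expect m u fun A => ⨆ h : localized H T r, RuPlus A (onSampleSq z h)) ≤ ψ r) ∨
      (m ≤ u ∧ ∀ r, s ≤ r →
        max (expect m u fun A => ⨆ h : localized H T r, RmMinus A (onSample z h))
          (expect m u fun A => ⨆ h : localized H T r, RmPlus A (onSampleSq z h)) ≤ ψ r))
    {x : ℝ} (hx : 0 < x) (hx_pivot : 1 ≤ x ∨ ∃ h₀ ∈ H, (∀ i, h₀ (z i) = 0) ∧ T h₀ ≤ ρ) :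
    1 - Real.exp (-x) ≤ prob m u fun A => ∀ h ∈ H,
      avg A (onSample z h) ≤ avg Aᶜ (onSample z h) + T h / K + 2 ^ 14 * (1 + K) * ρ +
        2 ^ 14 * (1 + K) * max 1 H₀ ^ 2 * x / (min m u : ℕ) := by
  rcases h_local with ⟨hum, h_test⟩ | ⟨hmu, h_train⟩
  · convert one_sub_exp_neg_le_prob_of_test_le_train hu hum hK hH hT hψ hs hsρ h_test hx hx_pivot
      using 6
    rw [min_eq_right hum]
    ring
  · convert one_sub_exp_neg_le_prob_of_train_le_test hm hmu hK hH hT hψ hs hsρ h_train hx hx_pivot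
      using 6
    rw [min_eq_left hmu]
    ring

theorem mainTheorem3 (K : ℝ) (hK : 1 < K) :
    ∃ c₀ : ℝ, 0 < c₀ ∧ ∀ H₀ : ℝ, 0 < H₀ → ∃ c₁ : ℝ, 0 < c₁ ∧
      ∀ (m u : ℕ), 0 < m → 0 < u →
      ∀ (Z : Type*) (z : Fin (m + u) → Z) (H : Set (Z → ℝ)),
        (∀ h ∈ H, ∀ i, |h (z i)| ≤ H₀) →
      ∀ (T : (Z → ℝ) → ℝ), (∀ h ∈ H, TLC.Tn z h ≤ T h) →
      ∀ (ψu ψm : ℝ → ℝ) (ru rm : ℝ),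
        TLC.IsSubRoot ψu → TLC.IsFixedPointOf ψu ru →
        TLC.IsSubRoot ψm → TLC.IsFixedPointOf ψm rm →
        (∀ r, ru ≤ r →
          max
            (TLC.expect m u fun A =>
              ⨆ h : TLC.localized H T r, TLC.RuPlus A (TLC.onSample z h))
            (TLC.expect m u fun A =>
              ⨆ h : TLC.localized H T r, TLC.RuPlus A (TLC.onSampleSq z h))
          ≤ ψu r) →
        (∀ r, rm ≤ r →
          max
            (TLC.expect m u fun A =>
              ⨆ h : TLC.localized H T r, TLC.RmMinus A (TLC.onSample z h))
            (TLC.expect m u fun A =>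
              ⨆ h : TLC.localized H T r, TLC.RmPlus A (TLC.onSampleSq z h))
          ≤ ψm r) →
      ∀ x : ℝ, 0 < x →
        (1 ≤ x ∨ ∃ h₀ ∈ H, (∀ i, h₀ (z i) = 0) ∧ T h₀ ≤ max ru rm) →
        1 - Real.exp (-x) ≤
          TLC.prob m u (fun A => ∀ h ∈ H,
            TLC.avg A (TLC.onSample z h) ≤
              TLC.avg Aᶜ (TLC.onSample z h) + T h / K + c₀ * (ru + rm)
                + c₁ * x / (min m u : ℕ)) := by
  refine ⟨2 ^ 14 * (1 + K), by positivity, fun H₀ _ =>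
    ⟨2 ^ 14 * (1 + K) * max 1 H₀ ^ 2, by positivity, ?_⟩⟩
  intro m u hm hu Z z H hH T hT ψu ψm ru rm hψu hru hψm hrm h_test h_train x hx hx_pivot
  have hru₀ : 0 ≤ ru := hru.1.1
  have hrm₀ : 0 ≤ rm := hrm.1.1
  have h_pivot : 1 ≤ x ∨ ∃ h₀ ∈ H, (∀ i, h₀ (z i) = 0) ∧ T h₀ ≤ ru + rm :=
    hx_pivot.imp_right fun ⟨h₀, hh₀, hz, hT₀⟩ =>
      ⟨h₀, hh₀, hz, hT₀.trans (max_le_add_of_nonneg hru₀ hrm₀)⟩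
  have hK₀ : 0 < K := zero_lt_one.trans hK
  rcases le_total u m with hum | hmu
  · exact mainTheorem3_general hK₀ hm hu hH hT hψu hru (le_add_of_nonneg_right hrm₀)
      (.inl ⟨hum, h_test⟩) hx h_pivot
  · exact mainTheorem3_general hK₀ hm hu hH hT hψm hrm (le_add_of_nonneg_left hru₀)
      (.inr ⟨hmu, h_train⟩) hx h_pivot
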